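/- Let $F$ be a global field (a number field, or a finite extension of $k(t)$ with $k$ a finite field), let $\mathbb{H}$ be a quaternion algebra over $F$ (a central simple $F$-algebra of dimension $4$; the split algebra ${\rm M}(2,F)$ is allowed), and let $*$ be its canonical involution, i.e. the unique $F$-linear involutive anti-automorphism of $\mathbb{H}$ with $x x^*\in F$ for all $x\in\mathbb{H}$. Let $\mathbb{A}_F$ be the ring of adèles of $F$, formed over all places of $F$, and let $\mathbb{A}_{\mathbb{H}}=\mathbb{H}\otimes_F\mathbb{A}_F$ with the involution $(h\otimes r)^*=h^*\otimes r$. For $n\ge 1$ let $A={\rm M}(n,\mathbb{A}_{\mathbb{H}})$ with the involution $(a_{ij})^*=(a_{ji}^*)$, and let $A^{\rm sym}=\{s\in A: s^*=s\}$. Say that a pair $(a,c)\in A^2$ is admissible if $Aa+Ac=A$ and $a^*c\in A^{\rm sym}$, and that it has a decomposition of length $m$ if there are $s_0,\dots,s_{m-1}\in A^{\rm sym}$ and $r_{-1}=a,\ r_0=c,\ r_1,\dots,r_m\in A$ such that $r_{i-1}=s_ir_i+r_{i+1}$ for $0\le i\le m-1$ and $r_m\in A^\times$. The ring $A$ is called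 $*$-Euclidean if every admissible pair has a decomposition of some length; its length is the minimum $m$ such that every admissible pair has a decomposition of length $m$. Then: (i) if ${\rm char}(F)=2$, then $A$ is $*$-Euclidean of length $1$; (ii) if ${\rm char}(F)\neq 2$, then $A$ is not $*$-Euclidean. -/

import Mathlib

open IsDedekindDomain

/-- An element of the fraction field of a Dedekind domain `R` lies in all but finitely many of
the nontrivial valuation rings containing `R`. -/
theorem ValuationSubring.finite_notMem_of_isDedekindDomain (R : Type*) {F : Type*} [CommRing R]
    [IsDedekindDomain R] [Field F] [Algebra R F] [IsFractionRing R F] (x : F) :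
    {v : ValuationSubring F | v ≠ ⊤ ∧ (∀ r : R, algebraMap R F r ∈ v) ∧ x ∉ v}.Finite := by
  classical
  have key : ∀ v : ValuationSubring F, v ≠ ⊤ → (∀ r : R, algebraMap R F r ∈ v) →
      ∃ p : HeightOneSpectrum R, (p.valuation F).valuationSubring = v := by
    intro v hv hR
    let f : R →+* v := (algebraMap R F).codRestrict v.toSubring hR
    have hf : ∀ r, ((f r : v) : F) = algebraMap R F r := fun r ↦ rfl
    have hunit : ∀ r : R, r ∉ (IsLocalRing.maximalIdeal v).comap f →
        (algebraMap R F r)⁻¹ ∈ v := by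
      intro r hr
      have hu : IsUnit (f r) := by simpa using hr
      obtain ⟨w, hw⟩ := hu.exists_right_inv
      have h1 : algebraMap R F r * (w : F) = 1 := congrArg Subtype.val hw
      rw [inv_eq_of_mul_eq_one_right h1]
      exact w.2
    let p : HeightOneSpectrum R :=
      { asIdeal := (IsLocalRing.maximalIdeal v).comap f
        isPrime := inferInstance
        ne_bot := by
          intro hbot
          refine hv (ValuationSubring.ext _ _ fun y ↦ ⟨fun _ ↦ ValuationSubring.mem_top y, fun _ ↦ ?_⟩)
          obtain ⟨a, b, hb, rfl⟩ := IsFractionRing.div_surjective R y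
          rw [div_eq_mul_inv]
          refine v.mul_mem _ _ (hR a) (hunit b ?_)
          rw [hbot]
          simpa using nonZeroDivisors.ne_zero hb }
    refine ⟨p, ?_⟩
    rw [← HeightOneSpectrum.valuationSubringAtPrime_eq_valuationSubring]
    refine ValuationSubring.eq_of_le_of_ne_top _ ?_ hv
    rw [HeightOneSpectrum.valuationSubringAtPrime_eq_valuationSubring]
    intro y hy
    obtain ⟨a, ⟨b, hb⟩, hab⟩ := HeightOneSpectrum.exists_primeCompl_mul_eq_of_integer p y hy
    have hb0 : algebraMap R F b ≠ 0 := by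
      intro h0
      rw [map_eq_zero_iff _ (IsFractionRing.injective R F)] at h0
      exact hb (h0 ▸ Ideal.zero_mem _)
    rw [eq_div_of_mul_eq hb0 hab, div_eq_mul_inv]
    exact v.mul_mem _ _ (hR a) (hunit b hb)
  refine ((HeightOneSpectrum.Support.finite R x).image
    (fun p ↦ (p.valuation F).valuationSubring)).subset ?_
  rintro v ⟨hv, hR, hx⟩
  obtain ⟨p, rfl⟩ := key v hv hR
  exact ⟨p, by simpa [HeightOneSpectrum.Support] using hx, rfl⟩

theorem ValuationSubring.mem_of_isIntegral_of_le {F : Type*} [Field F] (v : ValuationSubring F)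
    {R : Type*} [CommRing R] [Algebra R F] (hR : ∀ r : R, algebraMap R F r ∈ v) (x : F)
    (hx : IsIntegral R x) : x ∈ v := by
  let f : R →+* v := (algebraMap R F).codRestrict v.toSubring hR
  let _ : Algebra R v := f.toAlgebra
  have : IsScalarTower R v F := IsScalarTower.of_algebraMap_eq fun _ ↦ rfl
  obtain ⟨y, hy⟩ := IsIntegrallyClosed.isIntegral_iff.mp (hx.tower_top (A := v))
  rw [← hy]; exact y.2

theorem ValuationSubring.finite_notMem_of_isSeparable (R K : Type*) {F : Type*} [CommRing R]
    [IsDedekindDomain R] [Field K] [Algebra R K] [IsFractionRing R K] [Field F] [Algebra R F]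
    [Algebra K F] [IsScalarTower R K F] [FiniteDimensional K F] [Algebra.IsSeparable K F] (x : F) :
    {v : ValuationSubring F | v ≠ ⊤ ∧ (∀ r : R, algebraMap R F r ∈ v) ∧ x ∉ v}.Finite := by
  have : IsDedekindDomain (integralClosure R F) :=
    IsIntegralClosure.isDedekindDomain R K F (integralClosure R F)
  have : IsFractionRing (integralClosure R F) F :=
    integralClosure.isFractionRing_of_finite_extension K F
  refine (ValuationSubring.finite_notMem_of_isDedekindDomain (integralClosure R F) x).subset ?_
  rintro v ⟨hv, hR, hx⟩
  exact ⟨hv, fun r ↦ v.mem_of_isIntegral_of_le hR _ r.2, hx⟩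

theorem ValuationSubring.pow_mem_iff {F : Type*} [Field F] (v : ValuationSubring F) (x : F) {n : ℕ}
    (hn : n ≠ 0) : x ^ n ∈ v ↔ x ∈ v := by
  rw [← v.valuation_le_one_iff, ← v.valuation_le_one_iff, map_pow, pow_le_one_iff hn]

theorem ValuationSubring.finite_notMem_of_finiteDimensional (R K : Type*) {F : Type*} [CommRing R]
    [IsDedekindDomain R] [Field K] [Algebra R K] [IsFractionRing R K] [Field F] [Algebra R F]
    [Algebra K F] [IsScalarTower R K F] [FiniteDimensional K F] (x : F) :
    {v : ValuationSubring F | v ≠ ⊤ ∧ (∀ r : R, algebraMap R F r ∈ v) ∧ x ∉ v}.Finite := by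
  let E := separableClosure K F
  obtain ⟨q, hq⟩ := ExpChar.exists E
  have hq0 := expChar_pos E q
  have hpow : ∀ y : F, ∃ (n : ℕ) (z : E), n ≠ 0 ∧ algebraMap E F z = y ^ n := fun y ↦ by
    obtain ⟨n, z, hz⟩ := IsPurelyInseparable.pow_mem E q y
    exact ⟨q ^ n, z, (pow_pos hq0 n).ne', hz⟩
  have hmem : ∀ (y : F) (n : ℕ) (z : E), n ≠ 0 → algebraMap E F z = y ^ n →
      ∀ v : ValuationSubring F, z ∈ v.comap (algebraMap E F) ↔ y ∈ v := by
    intro y n z hn hz v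
    rw [ValuationSubring.mem_comap, hz, v.pow_mem_iff y hn]
  have hinj : Function.Injective
      (fun v : ValuationSubring F ↦ v.comap (algebraMap E F)) := by
    intro v w hvw
    refine ValuationSubring.ext _ _ fun y ↦ ?_
    obtain ⟨n, z, hn, hz⟩ := hpow y
    rw [← hmem y n z hn hz v, ← hmem y n z hn hz w]
    simp only at hvw
    rw [hvw]
  obtain ⟨n, z, hn, hz⟩ := hpow x
  refine ((ValuationSubring.finite_notMem_of_isSeparable R K z).preimage
    hinj.injOn).subset ?_
  rintro v ⟨hv, hR, hx⟩
  refine ⟨fun h ↦ hv ?_, fun r ↦ ?_, fun h ↦ hx ((hmem x n z hn hz v).1 h)⟩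
  · apply hinj
    simp only [h]
    exact ValuationSubring.ext _ _ fun y ↦ by simp [ValuationSubring.mem_comap]
  · rw [ValuationSubring.mem_comap, IsScalarTower.algebraMap_apply R K E,
      ← IsScalarTower.algebraMap_apply K E F, ← IsScalarTower.algebraMap_apply R K F]
    exact hR r

theorem FunctionField.finite_notMem_of_X_mem (k : Type*) {F : Type*} [Field k] [Finite k] [Field F]
    [Algebra (RatFunc k) F] [FunctionField k F] (x : F) :
    {v : ValuationSubring F | v ≠ ⊤ ∧ algebraMap (RatFunc k) F RatFunc.X ∈ v ∧ x ∉ v}.Finite := by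
  let _ : Algebra (Polynomial k) F :=
    ((algebraMap (RatFunc k) F).comp (algebraMap (Polynomial k) (RatFunc k))).toAlgebra
  have : IsScalarTower (Polynomial k) (RatFunc k) F := IsScalarTower.of_algebraMap_eq fun _ ↦ rfl
  refine (ValuationSubring.finite_notMem_of_finiteDimensional (Polynomial k) (RatFunc k) x).subset ?_
  rintro v ⟨hv, hX, hx⟩
  refine ⟨hv, fun r ↦ ?_, hx⟩
  induction r using Polynomial.induction_on' with
  | add p q hp hq => rw [map_add]; exact v.add_mem _ _ hp hq
  | monomial n a =>
    rw [← Polynomial.C_mul_X_pow_eq_monomial, map_mul, map_pow]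
    refine v.mul_mem _ _ ?_ ?_
    · by_cases ha : a = 0
      · simp [ha]
      · have := Fintype.ofFinite k
        have h1 := FiniteField.pow_card_sub_one_eq_one a ha
        rw [← v.pow_mem_iff _ (Nat.sub_ne_zero_of_lt (Fintype.one_lt_card (α := k))), ← map_pow,
          ← map_pow, h1]
        simp
    · have h2 : algebraMap (Polynomial k) F Polynomial.X
          = algebraMap (RatFunc k) F RatFunc.X := by
        rw [IsScalarTower.algebraMap_apply (Polynomial k) (RatFunc k) F, RatFunc.algebraMap_X]
      rw [h2]
      exact pow_mem hX n

theorem FunctionField.finite_notMem (k : Type*) {F : Type*} [Field k] [Finite k] [Field F]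
    [Algebra (RatFunc k) F] [FunctionField k F] (x : F) :
    {v : ValuationSubring F | v ≠ ⊤ ∧ x ∉ v}.Finite := by
  have htr : Transcendental k (RatFunc.X⁻¹ : RatFunc k) := by
    intro h
    exact RatFunc.transcendental_X (by simpa using h.inv)
  let τ : RatFunc k →+* RatFunc k :=
    IsFractionRing.lift (transcendental_iff_injective.1 htr : Function.Injective
      ((Polynomial.aeval (RatFunc.X⁻¹ : RatFunc k)).toRingHom : Polynomial k →+* RatFunc k))
  have hτC : ∀ a : k, τ (algebraMap _ _ (Polynomial.C a)) = algebraMap _ _ (Polynomial.C a) := by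
    intro a
    simp only [τ, IsFractionRing.lift_algebraMap]
    simp [RatFunc.algebraMap_eq_C]
  have hτX : τ RatFunc.X = RatFunc.X⁻¹ := by
    rw [← RatFunc.algebraMap_X]
    simp only [τ, IsFractionRing.lift_algebraMap]
    simp
  have hττ : τ.comp τ = RingHom.id _ := by
    refine IsLocalization.ringHom_ext (nonZeroDivisors (Polynomial k)) ?_
    refine Polynomial.ringHom_ext (fun a ↦ ?_) ?_
    · simp [hτC, -RatFunc.algebraMap_C]
    · simp [RatFunc.algebraMap_X, hτX]
  let e : RatFunc k ≃+* RatFunc k := RingEquiv.ofRingHom τ τ hττ hττ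
  have h1 := FunctionField.finite_notMem_of_X_mem k x
  have h2 : {v : ValuationSubring F |
      v ≠ ⊤ ∧ algebraMap (RatFunc k) F RatFunc.X⁻¹ ∈ v ∧ x ∉ v}.Finite := by
    have hfin : @Module.Finite (RatFunc k) F _ _ ((algebraMap (RatFunc k) F).comp τ).toAlgebra.toModule := by
      refine @Module.Finite.of_equiv_equiv (RatFunc k) F (RatFunc k) F _ _ _ _ _
        ((algebraMap (RatFunc k) F).comp τ).toAlgebra e (RingEquiv.refl F) ?_ _
      refine RingHom.ext fun y ↦ ?_
      exact congrArg (algebraMap (RatFunc k) F) (RingHom.congr_fun hττ y)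
    have h3 := @FunctionField.finite_notMem_of_X_mem k F _ _ _
      ((algebraMap (RatFunc k) F).comp τ).toAlgebra hfin x
    rw [← hτX]
    exact h3
  refine (h1.union h2).subset ?_
  rintro v ⟨hv, hx⟩
  rcases v.mem_or_inv_mem (algebraMap (RatFunc k) F RatFunc.X) with h | h
  · exact Or.inl ⟨hv, h, hx⟩
  · exact Or.inr ⟨hv, by rwa [map_inv₀], hx⟩

theorem NumberField.finite_notMem {F : Type*} [Field F] [NumberField F] (x : F) :
    {v : ValuationSubring F | v ≠ ⊤ ∧ x ∉ v}.Finite := by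
  refine (ValuationSubring.finite_notMem_of_isSeparable ℤ ℚ x).subset ?_
  rintro v ⟨hv, hx⟩
  exact ⟨hv, fun r ↦ by simp, hx⟩

open scoped TensorProduct

/-- A quaternion algebra over a field `F`: a central simple `F`-algebra of dimension `4`. Both the
split algebra `M₂(F)` and quaternion division algebras are included. -/
class IsQuaternionAlgebra (F H : Type*) [Field F] [Ring H] [Algebra F H] : Prop extends
    Algebra.IsCentral F H, IsSimpleRing H where
  finrank_eq_four : Module.finrank F H = 4

/-- The canonical (standard) involution of a quaternion algebra: the `F`-linear involutive
anti-automorphism `σ` with `x * σ x ∈ F` for all `x`. On `M₂(F)` it is `h ↦ J * hᵀ * J⁻¹`, the adjugate.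
It exists on every quaternion algebra (`IsQuaternionAlgebra.exists_isCanonicalInvolution`) and is
unique (`IsCanonicalInvolution.unique`). -/
structure IsCanonicalInvolution {F H : Type*} [Field F] [Ring H] [Algebra F H]
    (σ : H →ₗ[F] H) : Prop where
  map_mul_rev : ∀ x y, σ (x * y) = σ y * σ x
  involutive : ∀ x, σ (σ x) = x
  mul_self_mem : ∀ x, ∃ c : F, x * σ x = algebraMap F H c

theorem IsCanonicalInvolution.exists_of_algEquiv {F H H' : Type*} [Field F] [Ring H] [Algebra F H]
    [Ring H'] [Algebra F H'] (e : H ≃ₐ[F] H') (h : ∃ σ : H' →ₗ[F] H', IsCanonicalInvolution σ) :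
    ∃ σ : H →ₗ[F] H, IsCanonicalInvolution σ := by
  obtain ⟨σ, h1, h2, h3⟩ := h
  refine ⟨e.symm.toLinearMap ∘ₗ σ ∘ₗ e.toLinearMap, fun x y ↦ ?_, fun x ↦ ?_, fun x ↦ ?_⟩
  · simp [h1]
  · simp [h2]
  · obtain ⟨c, hc⟩ := h3 (e x)
    refine ⟨c, e.injective ?_⟩
    simpa using hc

theorem IsCanonicalInvolution.exists_matrix (F : Type*) [Field F] :
    ∃ σ : Matrix (Fin 2) (Fin 2) F →ₗ[F] Matrix (Fin 2) (Fin 2) F, IsCanonicalInvolution σ := by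
  refine ⟨(LinearMap.toSpanSingleton F _ 1) ∘ₗ Matrix.traceLinearMap (Fin 2) F F - LinearMap.id,
    fun x y ↦ ?_, fun x ↦ ?_, fun x ↦ ⟨x.det, ?_⟩⟩
  · ext i j
    fin_cases i <;> fin_cases j <;>
      simp [Matrix.trace_fin_two, Matrix.mul_apply, Fin.sum_univ_two] <;> ring
  · ext i j
    fin_cases i <;> fin_cases j <;> simp [Matrix.trace_fin_two] <;> ring
  · rw [Algebra.algebraMap_eq_smul_one]
    ext i j
    fin_cases i <;> fin_cases j <;>
      simp [Matrix.trace_fin_two, Matrix.mul_apply, Matrix.det_fin_two, Fin.sum_univ_two] <;> ring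

section division

variable {F D : Type*} [Field F] [DivisionRing D] [Algebra F D] [Algebra.IsCentral F D]

theorem IsCanonicalInvolution.exists_eq_of_commute (hD : Module.finrank F D = 4) (x y : D)
    (hx : ∀ c : F, x ≠ algebraMap F D c) (hxy : x * y = y * x) :
    ∃ a b : F, y = algebraMap F D a + b • x := by
  have hfd : FiniteDimensional F D := FiniteDimensional.of_finrank_pos (by omega)
  let C : Submodule F D := Subalgebra.toSubmodule (Subalgebra.centralizer F {x})
  have hC : ∀ z, z ∈ C ↔ x * z = z * x := fun z ↦ by
    simp [C, Subalgebra.mem_centralizer_iff]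
  have hxc : ∃ w, w ∉ C := by
    by_contra! h
    have : x ∈ Subalgebra.center F D := by
      rw [Subalgebra.mem_center_iff]
      exact fun b ↦ (((hC b).1 (h b))).symm
    obtain ⟨c, hc⟩ := Algebra.mem_bot.1 (Algebra.IsCentral.out this)
    exact hx c hc.symm
  obtain ⟨w, hw⟩ := hxc
  let f : (C × C) →ₗ[F] D :=
    LinearMap.coprod C.subtype ((LinearMap.mulLeft F w) ∘ₗ C.subtype)
  have hf : Function.Injective f := by
    rw [← LinearMap.ker_eq_bot, LinearMap.ker_eq_bot']
    rintro ⟨⟨a, ha⟩, ⟨b, hb⟩⟩ h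
    simp only [f, LinearMap.coprod_apply, Submodule.coe_subtype, LinearMap.comp_apply,
      LinearMap.mulLeft_apply] at h
    have hb0 : b = 0 := by
      by_contra hb0
      apply hw
      have h1 : w = -a * b⁻¹ := by
        rw [eq_mul_inv_iff_mul_eq₀ hb0]
        exact (neg_eq_of_add_eq_zero_right h).symm
      have hbi : x * b⁻¹ = b⁻¹ * x := by
        have : Commute x b := (hC b).1 hb
        exact this.inv_right₀
      rw [hC, h1, ← mul_assoc, mul_neg, (hC a).1 ha, neg_mul, neg_mul, neg_mul,
        mul_assoc, mul_assoc, hbi]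
    subst hb0
    have ha0 : a = 0 := by simpa using h
    subst ha0
    rfl
  have hle := LinearMap.finrank_le_finrank_of_injective hf
  rw [Module.finrank_prod, hD] at hle
  have hli : LinearIndependent F ![(1 : D), x] := by
    rw [LinearIndependent.pair_iff]
    intro s t hst
    have ht : t = 0 := by
      by_contra ht
      apply hx (-(t⁻¹ * s))
      have h1 : t • x = -(s • 1) := (neg_eq_of_add_eq_zero_right hst).symm
      have h2 : x = t⁻¹ • (t • x) := by rw [smul_smul, inv_mul_cancel₀ ht, one_smul]
      rw [h2, h1, Algebra.algebraMap_eq_smul_one, smul_neg, smul_smul, neg_smul]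
    subst ht
    simpa using hst
  have hspan : Submodule.span F {(1 : D), x} = C := by
    refine Submodule.eq_of_le_of_finrank_le ?_ ?_
    · rw [Submodule.span_le]
      rintro z (rfl | rfl)
      · exact (hC _).2 (by simp)
      · exact (hC _).2 rfl
    · have := finrank_span_eq_card hli
      rw [Matrix.range_cons_cons_empty, Fintype.card_fin] at this
      omega
  have hy : y ∈ Submodule.span F {(1 : D), x} := hspan ▸ (hC y).2 hxy
  obtain ⟨a, b, hab⟩ := Submodule.mem_span_pair.1 hy
  exact ⟨a, b, by rw [Algebra.algebraMap_eq_smul_one, hab]⟩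

theorem IsCanonicalInvolution.exists_divisionRing (hD : Module.finrank F D = 4) :
    ∃ σ : D →ₗ[F] D, IsCanonicalInvolution σ := by
  have hinj : Function.Injective (algebraMap F D) := (algebraMap F D).injective
  have hex : ∀ x : D, ∃ t n : F, x * x = t • x - algebraMap F D n ∧
      ∀ c : F, x = algebraMap F D c → t = 2 * c := by
    intro x
    by_cases hx : ∃ c : F, x = algebraMap F D c
    · obtain ⟨c, rfl⟩ := hx
      refine ⟨2 * c, c * c, ?_, fun d hd ↦ by rw [hinj hd]⟩
      rw [Algebra.smul_def]
      simp only [← map_mul, ← map_sub]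
      congr 1; ring
    · push Not at hx
      obtain ⟨a, b, h⟩ := exists_eq_of_commute hD x (x * x) hx (mul_assoc _ _ _).symm
      exact ⟨b, -a, by rw [h, map_neg]; abel, fun c hc ↦ absurd hc (hx c)⟩
  choose T N hTN hTc using hex
  have hTalg : ∀ c : F, T (algebraMap F D c) = 2 * c := fun c ↦ hTc _ c rfl
  have huniq : ∀ (x : D) (t n : F), (∀ c : F, x ≠ algebraMap F D c) →
      x * x = t • x - algebraMap F D n → T x = t := by
    intro x t n hx h
    by_contra hne
    have h1 : (T x - t) • x = algebraMap F D (N x - n) := by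
      rw [sub_smul, map_sub]
      have := (hTN x).symm.trans h
      rw [sub_eq_sub_iff_sub_eq_sub] at this
      exact this
    apply hx ((T x - t)⁻¹ * (N x - n))
    rw [map_mul, ← h1, ← Algebra.smul_def, smul_smul, inv_mul_cancel₀ (sub_ne_zero.2 hne), one_smul]
  have haff : ∀ (x : D) (a b : F), T (algebraMap F D a + b • x) = 2 * a + b * T x := by
    intro x a b
    by_cases hx : ∃ c : F, x = algebraMap F D c
    · obtain ⟨c, rfl⟩ := hx
      rw [Algebra.smul_def, ← map_mul, ← map_add, hTalg, hTalg]; ring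
    push Not at hx
    by_cases hb : b = 0
    · simp [hb, hTalg]
    refine huniq _ _ (a * a + a * b * T x + b * b * N x) ?_ ?_
    · intro c hc
      apply hx (b⁻¹ * (c - a))
      rw [map_mul, map_sub, ← hc, add_sub_cancel_left, ← Algebra.smul_def, smul_smul,
        inv_mul_cancel₀ hb, one_smul]
    · have h := hTN x
      simp only [Algebra.algebraMap_eq_smul_one] at h ⊢
      simp only [mul_add, add_mul, smul_mul_assoc, mul_smul_comm, one_mul, mul_one, h]
      module
  have hcomm : ∀ x y : D, T (x + y) = T x + T y := by
    intro x y
    by_cases hx : ∃ c : F, x = algebraMap F D c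
    · obtain ⟨c, rfl⟩ := hx
      have := haff y c 1
      rw [one_smul, one_mul] at this
      rw [this, hTalg]
    push Not at hx
    by_cases hxy : x * y = y * x
    · obtain ⟨a, b, rfl⟩ := exists_eq_of_commute hD x y hx hxy
      have h1 : x + (algebraMap F D a + b • x) = algebraMap F D a + (1 + b) • x := by
        rw [add_smul, one_smul]; abel
      rw [h1, haff, haff]; ring
    · have h1 := hTN (x + y)
      have hX := hTN x
      have hY := hTN y
      have h2 : x * y + y * x = (T (x + y) - T x) • x + (T (x + y) - T y) • y
          + algebraMap F D (N x + N y - N (x + y)) := by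
        simp only [mul_add, add_mul, hX, hY] at h1
        have h3 : x * y + y * x = T (x + y) • (x + y) - algebraMap F D (N (x + y))
            - (T x • x - algebraMap F D (N x)) - (T y • y - algebraMap F D (N y)) := by
          rw [← h1]; abel
        rw [h3, map_sub, map_add]
        module
      have h4 : (T (x + y) - T y - T x) • (x * y - y * x) = 0 := by
        have h5 : x * (x * y + y * x) - (x * y + y * x) * x = T x • (x * y - y * x) := by
          have : x * (x * y + y * x) - (x * y + y * x) * x = (x * x) * y - y * (x * x) := by
            noncomm_ring
          rw [this, hX, sub_mul, mul_sub, smul_mul_assoc, mul_smul_comm, Algebra.commutes]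
          module
        rw [h2] at h5
        simp only [mul_add, add_mul, mul_smul_comm, smul_mul_assoc, Algebra.commutes] at h5
        rw [sub_smul, ← h5]
        module
      rcases smul_eq_zero.1 h4 with h | h
      · linear_combination h
      · exact absurd (sub_eq_zero.1 h) hxy
  have hsmul : ∀ (c : F) (x : D), T (c • x) = c * T x := by
    intro c x
    have := haff x 0 c
    simpa using this
  have hT0 : T 0 = 0 := by simpa using hTalg 0
  have hpol : ∀ x y : D, x * y + y * x =
      T x • y + T y • x + algebraMap F D (N x + N y - N (x + y)) := by
    intro x y
    have h1 := hTN (x + y)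
    rw [hcomm] at h1
    simp only [mul_add, add_mul, hTN x, hTN y] at h1
    have h3 : x * y + y * x = (T x + T y) • x + (T x + T y) • y - algebraMap F D (N (x + y))
        - (T x • x - algebraMap F D (N x)) - (T y • y - algebraMap F D (N y)) := by
      rw [← smul_add, ← h1]; abel
    rw [h3, map_sub, map_add]
    module
  have hmul : ∀ x y : D, N x + N y - N (x + y) = T (x * y) - T x * T y := by
    intro x y
    set b := N x + N y - N (x + y) with hb
    by_cases hxy : ∃ c : F, x * y = algebraMap F D c
    · obtain ⟨c, hc⟩ := hxy
      have hp := hpol x y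
      by_cases hx0 : x = 0
      · subst hx0
        have : algebraMap F D b = 0 := by simpa [hT0, hb] using hp.symm
        rw [map_eq_zero_iff _ hinj] at this
        simpa [hT0] using this
      have hN0 : N x ≠ 0 := by
        intro h0
        have h1 := hTN x
        rw [h0, map_zero, sub_zero, Algebra.smul_def] at h1
        have h2 := mul_right_cancel₀ hx0 h1
        have h3 := hTc x _ h2
        have h4 : T x = 0 := by linear_combination -h3
        rw [h4, map_zero] at h2
        exact hx0 h2
      have hyx : y * x = algebraMap F D c := by
        apply mul_left_cancel₀ hx0
        rw [← mul_assoc, hc, Algebra.commutes]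
      have hy : y = algebraMap F D (c * T x / N x) + (-(c / N x)) • x := by
        have h1 : N x • y = (c * T x) • (1 : D) - c • x := by
          have h2 : algebraMap F D (N x) = T x • x - x * x := by rw [hTN x]; abel
          rw [Algebra.smul_def, h2, sub_mul, smul_mul_assoc, mul_assoc, hc,
            ← Algebra.commutes, ← Algebra.smul_def, Algebra.algebraMap_eq_smul_one, smul_smul,
            mul_comm]
        have h3 : y = (N x)⁻¹ • (N x • y) := by rw [smul_smul, inv_mul_cancel₀ hN0, one_smul]
        rw [h3, h1, Algebra.algebraMap_eq_smul_one, smul_sub, smul_smul, smul_smul, neg_smul,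
          sub_eq_add_neg]
        congr 2
        · field_simp
        · congr 1
          field_simp
      have hTy : T y = c * T x / N x := by
        rw [hy, haff]; field_simp; ring
      rw [hc, hTalg]
      apply hinj
      rw [hc, hyx] at hp
      have h5 : algebraMap F D b = algebraMap F D (2 * c) - T x • y - T y • x := by
        rw [two_mul, map_add, hp]; abel
      rw [h5, hTy, hy]
      simp only [Algebra.algebraMap_eq_smul_one]
      match_scalars
      · field_simp
      · field_simp
        ring
    · push Not at hxy
      have h := huniq (x * y) (T x * T y + b) (N x * N y) hxy (by
        have h1 : x * y * (x * y) = x * (x * y + y * x) * y - (x * x) * (y * y) := by noncomm_ring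
        rw [h1, hpol x y, ← hb]
        have h2 : x * (T x • y + T y • x + algebraMap F D b) * y
            = T x • (x * (y * y)) + T y • ((x * x) * y) + b • (x * y) := by
          rw [mul_add, mul_add, add_mul, add_mul, ← Algebra.commutes, ← Algebra.smul_def]
          simp only [mul_smul_comm, smul_mul_assoc, mul_assoc]
        rw [h2, hTN x, hTN y]
        simp only [Algebra.algebraMap_eq_smul_one]
        simp only [mul_sub, sub_mul, mul_smul_comm, smul_mul_assoc, mul_one, one_mul]
        module)
      rw [h]; ring
  let τ : D →ₗ[F] F :=
    { toFun := T
      map_add' := hcomm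
      map_smul' := fun c x ↦ by simp [hsmul] }
  refine ⟨(Algebra.linearMap F D) ∘ₗ τ - LinearMap.id, fun x y ↦ ?_, fun x ↦ ?_, fun x ↦ ⟨N x, ?_⟩⟩
  · have h1 := hpol x y
    rw [hmul x y] at h1
    simp only [LinearMap.sub_apply, LinearMap.comp_apply, Algebra.linearMap_apply,
      LinearMap.id_apply, τ, LinearMap.coe_mk, AddHom.coe_mk]
    have h2 : algebraMap F D (T (x * y)) = x * y + y * x - T x • y - T y • x
        + algebraMap F D (T x * T y) := by
      rw [h1, map_sub]; abel
    rw [h2]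
    simp only [Algebra.algebraMap_eq_smul_one]
    simp only [mul_sub, sub_mul, mul_smul_comm, smul_mul_assoc, mul_one, one_mul]
    module
  · simp only [LinearMap.sub_apply, LinearMap.comp_apply, Algebra.linearMap_apply,
      LinearMap.id_apply, map_sub, τ, LinearMap.coe_mk, AddHom.coe_mk, hTalg, map_mul, map_ofNat]
    rw [two_mul]; abel
  · simp only [LinearMap.sub_apply, LinearMap.comp_apply, Algebra.linearMap_apply,
      LinearMap.id_apply, τ, LinearMap.coe_mk, AddHom.coe_mk]
    rw [mul_sub, hTN x, ← Algebra.commutes, ← Algebra.smul_def]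
    abel

end division

theorem IsQuaternionAlgebra.exists_isCanonicalInvolution (F H : Type*) [Field F] [Ring H]
    [Algebra F H] [IsQuaternionAlgebra F H] : ∃ σ : H →ₗ[F] H, IsCanonicalInvolution σ := by
  have h4 : Module.finrank F H = 4 := finrank_eq_four
  have hfd : FiniteDimensional F H := FiniteDimensional.of_finrank_pos (by omega)
  have : IsArtinianRing H := IsArtinianRing.of_finite F H
  obtain ⟨n, hn, D, _, _, hDf, ⟨e⟩⟩ := IsSimpleRing.exists_algEquiv_matrix_divisionRing_finite F H
  have hdim : n * n * Module.finrank F D = 4 := by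
    rw [← h4, e.toLinearEquiv.finrank_eq, Module.finrank_matrix]
    simp
  have hn2 : n ≤ 2 := by
    by_contra! h
    have hD : 0 < Module.finrank F D := Module.finrank_pos
    nlinarith [Nat.mul_le_mul h h]
  have hn0 := hn.out
  refine IsCanonicalInvolution.exists_of_algEquiv e ?_
  interval_cases n
  · omega
  · let e1 : Matrix (Fin 1) (Fin 1) D ≃ₐ[F] D := (AlgEquiv.ofBijective
      (Matrix.scalarAlgHom (Fin 1) F : D →ₐ[F] _) ⟨fun a b h ↦ by simpa using h, fun M ↦ ⟨M 0 0, by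
        ext i j; fin_cases i; fin_cases j; simp⟩⟩).symm
    have : Algebra.IsCentral F D := Algebra.IsCentral.of_algEquiv F _ _ (e.trans e1)
    exact IsCanonicalInvolution.exists_of_algEquiv e1
      (IsCanonicalInvolution.exists_divisionRing (by omega))
  · have hD1 : Module.finrank F D = 1 := by omega
    have hbij : Function.Bijective (algebraMap F D) :=
      Algebra.finrank_eq_one_iff_bijective_algebraMap.mp hD1
    let e2 : F ≃ₐ[F] D := AlgEquiv.ofBijective (Algebra.ofId F D) hbij
    exact IsCanonicalInvolution.exists_of_algEquiv e2.mapMatrix.symm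
      (IsCanonicalInvolution.exists_matrix F)

/-- The canonical involution of a quaternion algebra. -/
noncomputable def canonicalInvolution (F H : Type*) [Field F] [Ring H] [Algebra F H]
    [IsQuaternionAlgebra F H] : H →ₗ[F] H :=
  (IsQuaternionAlgebra.exists_isCanonicalInvolution F H).choose

theorem isCanonicalInvolution_canonicalInvolution (F H : Type*) [Field F] [Ring H] [Algebra F H]
    [IsQuaternionAlgebra F H] : IsCanonicalInvolution (canonicalInvolution F H) :=
  (IsQuaternionAlgebra.exists_isCanonicalInvolution F H).choose_spec

theorem IsCanonicalInvolution.map_one {F H : Type*} [Field F] [Ring H] [Algebra F H]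
    {σ : H →ₗ[F] H} (h : IsCanonicalInvolution σ) : σ 1 = 1 := by
  have h1 := h.map_mul_rev (σ 1) 1
  rwa [mul_one, h.involutive, mul_one, eq_comm] at h1

theorem IsCanonicalInvolution.map_algebraMap {F H : Type*} [Field F] [Ring H] [Algebra F H]
    {σ : H →ₗ[F] H} (h : IsCanonicalInvolution σ) (c : F) :
    σ (algebraMap F H c) = algebraMap F H c := by
  rw [Algebra.algebraMap_eq_smul_one, map_smul, h.map_one]

theorem IsCanonicalInvolution.add_self_mem {F H : Type*} [Field F] [Ring H] [Algebra F H]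
    {σ : H →ₗ[F] H} (h : IsCanonicalInvolution σ) (x : H) :
    ∃ c : F, x + σ x = algebraMap F H c := by
  obtain ⟨c, hc⟩ := h.mul_self_mem x
  obtain ⟨d, hd⟩ := h.mul_self_mem (x + 1)
  refine ⟨d - c - 1, ?_⟩
  rw [map_add, h.map_one, mul_add, add_mul, hc] at hd
  rw [map_sub, map_sub, ← hd, _root_.map_one]
  noncomm_ring

theorem IsCanonicalInvolution.unique {F H : Type*} [Field F] [Ring H] [Algebra F H]
    {σ τ : H →ₗ[F] H} (hσ : IsCanonicalInvolution σ) (hτ : IsCanonicalInvolution τ) : σ = τ := by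
  ext x
  by_cases hx : ∃ c : F, x = algebraMap F H c
  · obtain ⟨c, rfl⟩ := hx
    rw [hσ.map_algebraMap, hτ.map_algebraMap]
  push Not at hx
  obtain ⟨s, hs⟩ := hσ.add_self_mem x
  obtain ⟨t, ht⟩ := hτ.add_self_mem x
  obtain ⟨m, hm⟩ := hσ.mul_self_mem x
  obtain ⟨n, hn⟩ := hτ.mul_self_mem x
  have hs' : σ x = algebraMap F H s - x := by rw [← hs]; abel
  have ht' : τ x = algebraMap F H t - x := by rw [← ht]; abel
  suffices s = t by rw [hs', ht', this]
  by_contra hne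
  rw [hs', mul_sub, ← Algebra.commutes, ← Algebra.smul_def] at hm
  rw [ht', mul_sub, ← Algebra.commutes, ← Algebra.smul_def] at hn
  have h1 : (s - t) • x = algebraMap F H (m - n) := by
    rw [sub_smul, map_sub, ← hm, ← hn]; abel
  apply hx ((s - t)⁻¹ * (m - n))
  rw [map_mul, ← h1, ← Algebra.smul_def, smul_smul, inv_mul_cancel₀ (sub_ne_zero.2 hne), one_smul]

/-- A global field: a number field, or a finite extension of `k(t)` with `k` a finite field. -/
class IsGlobalField (F : Type*) [Field F] : Prop where
  numberField_or_functionField : NumberField F ∨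
    ∃ (k : Type) (_ : Field k) (_ : Finite k) (_ : Algebra (RatFunc k) F), FunctionField k F

/-- An element of a global field is integral at all but finitely many places. -/
theorem IsGlobalField.finite_notMem {F : Type*} [Field F] [IsGlobalField F] (x : F) :
    {v : ValuationSubring F | v ≠ ⊤ ∧ x ∉ v}.Finite := by
  rcases IsGlobalField.numberField_or_functionField (F := F) with h | ⟨k, _, _, _, h⟩
  · exact NumberField.finite_notMem x
  · exact FunctionField.finite_notMem k x

namespace GlobalField

/-- The non-Archimedean places of a global field `F`, given by the discrete valuation rings of `F`.
For a number field these are the localizations of the ring of integers at its nonzero primes; for a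
function field these are all its places, those above `t = ∞` included. -/
def FinitePlace (F : Type*) [Field F] : Type _ :=
  {v : ValuationSubring F // IsDiscreteValuationRing v}

namespace FinitePlace

variable {F : Type*} [Field F] (v : FinitePlace F)

instance : IsDiscreteValuationRing v.1 := v.2

/-- The completion `F_v`. -/
abbrev Completion : Type _ :=
  (IsDiscreteValuationRing.maximalIdeal v.1).adicCompletion F

/-- The ring of integers `O_v` of `F_v`. -/
noncomputable abbrev integers : ValuationSubring v.Completion :=
  (IsDiscreteValuationRing.maximalIdeal v.1).adicCompletionIntegers F

theorem ne_top : v.1 ≠ ⊤ := by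
  intro h
  have h1 := v.2
  rw [h] at h1
  refine IsDiscreteValuationRing.not_isField (⊤ : ValuationSubring F)
    ⟨⟨0, 1, zero_ne_one⟩, mul_comm, fun {a} ha ↦ ?_⟩
  exact ⟨⟨(a : F)⁻¹, ValuationSubring.mem_top _⟩,
    Subtype.ext (mul_inv_cancel₀ (by simpa using ha))⟩

theorem coe_mem_integers_iff (x : F) : algebraMap F v.Completion x ∈ v.integers ↔ x ∈ v.1 := by
  have h1 : Valued.v (algebraMap F v.Completion x) =
      (IsDiscreteValuationRing.maximalIdeal v.1).valuation F x :=
    HeightOneSpectrum.valuedAdicCompletion_eq_valuation' _ x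
  rw [HeightOneSpectrum.mem_adicCompletionIntegers, h1]
  refine ⟨fun h ↦ ?_, fun h ↦ HeightOneSpectrum.valuation_le_one _ (⟨x, h⟩ : v.1)⟩
  obtain ⟨a, ha⟩ := IsDiscreteValuationRing.exists_lift_of_le_one h
  exact ha ▸ a.2

end FinitePlace

open scoped RestrictedProduct

/-- The restricted product of all `F_v` with respect to `O_v`, for `v` non-Archimedean. -/
def FiniteAdeleRing (F : Type*) [Field F] : Type _ :=
  Πʳ v : FinitePlace F, [v.Completion, v.integers]

noncomputable instance (F : Type*) [Field F] : CommRing (FiniteAdeleRing F) :=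
  inferInstanceAs <| CommRing <| Πʳ v : FinitePlace F, [v.Completion, v.integers]

/-- The diagonal embedding. -/
noncomputable def FiniteAdeleRing.diagonal (F : Type*) [Field F] [IsGlobalField F] :
    F →+* FiniteAdeleRing F where
  toFun x := ⟨fun v ↦ algebraMap F v.Completion x, by
    rw [Filter.eventually_cofinite]
    refine ((IsGlobalField.finite_notMem x).preimage Subtype.val_injective.injOn).subset ?_
    intro v hv
    exact ⟨FinitePlace.ne_top v, fun h ↦ hv ((FinitePlace.coe_mem_integers_iff v x).2 h)⟩⟩
  map_one' := Subtype.ext <| funext fun _ ↦ map_one _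
  map_mul' x y := Subtype.ext <| funext fun _ ↦ map_mul _ x y
  map_zero' := Subtype.ext <| funext fun _ ↦ map_zero _
  map_add' x y := Subtype.ext <| funext fun _ ↦ map_add _ x y

noncomputable instance (F : Type*) [Field F] [IsGlobalField F] : Algebra F (FiniteAdeleRing F) :=
  (FiniteAdeleRing.diagonal F).toAlgebra

/-- The ring of adeles `𝔸_F`. The first factor is the product of the completions at the Archimedean
places; there are none (and the factor is trivial) in positive characteristic. -/
def AdeleRing (F : Type*) [Field F] : Type _ :=
  NumberField.InfiniteAdeleRing F × FiniteAdeleRing F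

noncomputable instance (F : Type*) [Field F] : CommRing (AdeleRing F) :=
  inferInstanceAs <| CommRing <| NumberField.InfiniteAdeleRing F × FiniteAdeleRing F

noncomputable instance (F : Type*) [Field F] [IsGlobalField F] : Algebra F (AdeleRing F) :=
  inferInstanceAs <| Algebra F <| NumberField.InfiniteAdeleRing F × FiniteAdeleRing F

/-- The adelic quaternions `H ⊗_F 𝔸_F`. -/
def AdelicQuaternions (F H : Type*) [Field F] [IsGlobalField F] [Ring H] [Algebra F H] : Type _ :=
  H ⊗[F] AdeleRing F

noncomputable instance (F H : Type*) [Field F] [IsGlobalField F] [Ring H] [Algebra F H] :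
    Ring (AdelicQuaternions F H) :=
  inferInstanceAs <| Ring <| H ⊗[F] AdeleRing F

/-- The involution of `H ⊗_F 𝔸_F` induced by the canonical involution of `H`: it sends `h ⊗ r` to
`h* ⊗ r`, and so acts at every place as the canonical involution of `H ⊗_F F_v`. -/
noncomputable instance (F H : Type*) [Field F] [IsGlobalField F] [Ring H] [Algebra F H]
    [IsQuaternionAlgebra F H] : StarRing (AdelicQuaternions F H) where
  star := (canonicalInvolution F H).rTensor (AdeleRing F)
  star_involutive x := by
    have h : ((canonicalInvolution F H).rTensor (AdeleRing F)) ∘ₗ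
        ((canonicalInvolution F H).rTensor (AdeleRing F)) = LinearMap.id := by
      rw [← LinearMap.rTensor_comp, LinearMap.ext (g := LinearMap.id)
        (f := canonicalInvolution F H ∘ₗ canonicalInvolution F H)
        (isCanonicalInvolution_canonicalInvolution F H).involutive, LinearMap.rTensor_id]
    exact LinearMap.congr_fun h x
  star_add := map_add ((canonicalInvolution F H).rTensor (AdeleRing F))
  star_mul x y := by
    have h : ∀ x y : H ⊗[F] AdeleRing F, (canonicalInvolution F H).rTensor (AdeleRing F) (x * y) =
        (canonicalInvolution F H).rTensor (AdeleRing F) y *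
          (canonicalInvolution F H).rTensor (AdeleRing F) x := by
      intro x y
      induction x with
      | zero => simp
      | add x₁ x₂ h₁ h₂ => rw [add_mul, map_add, map_add, mul_add, h₁, h₂]
      | tmul a r =>
        induction y with
        | zero => simp
        | add y₁ y₂ h₁ h₂ => rw [mul_add, map_add, map_add, add_mul, h₁, h₂]
        | tmul b s =>
          rw [Algebra.TensorProduct.tmul_mul_tmul, LinearMap.rTensor_tmul, LinearMap.rTensor_tmul,
            LinearMap.rTensor_tmul, Algebra.TensorProduct.tmul_mul_tmul, mul_comm r s,
            (isCanonicalInvolution_canonicalInvolution F H).map_mul_rev]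
    exact h x y

end GlobalField

/-- The pair `(a, c)` has a decomposition of length `m`: there are symmetric `s₀, …, s_{m-1}` and
`r_{-1} = a`, `r₀ = c`, `r₁, …, r_m` with `r_{i-1} = s_i r_i + r_{i+1}` for `0 ≤ i < m` and `r_m` a unit.
The indices of `r` are shifted by one here: `r_{i-1}` is written `r i`. -/
def HasStarEuclideanDecomposition {A : Type*} [Ring A] [StarRing A] (a c : A) (m : ℕ) : Prop :=
  ∃ s r : ℕ → A, r 0 = a ∧ r 1 = c ∧
    (∀ i < m, IsSelfAdjoint (s i) ∧ r i = s i * r (i + 1) + r (i + 2)) ∧ IsUnit (r (m + 1))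

/-- `A a + A c = A` and `a* c` is symmetric. (`Ideal` means left ideal.) -/
def IsStarCoprimePair {A : Type*} [Ring A] [StarRing A] (a c : A) : Prop :=
  Ideal.span {a} ⊔ Ideal.span {c} = ⊤ ∧ IsSelfAdjoint (star a * c)

/-- `A` is `*`-Euclidean. -/
def IsStarEuclidean (A : Type*) [Ring A] [StarRing A] : Prop :=
  ∀ a c : A, IsStarCoprimePair a c → ∃ m, HasStarEuclideanDecomposition a c m

/-- The length of the `*`-Euclidean ring `A` is `m`: the minimum decomposition length that is valid
for all admissible pairs. -/
def IsStarEuclideanOfLength (A : Type*) [Ring A] [StarRing A] (m : ℕ) : Prop :=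
  IsLeast {m : ℕ | ∀ a c : A, IsStarCoprimePair a c → HasStarEuclideanDecomposition a c m} m

/-! Write $\mathbb{H}$ with a basis $1,i,j,ij$, where $i^2=\alpha+i$, $j^2=\beta$, $ji=(1-i)j$, a
presentation valid in every characteristic (`IsQuaternionAlgebra.exists_algEquiv`). Its coefficients
can be extended to any commutative ring, so $A$ becomes a ring of matrices with coordinates in the
adèles, and places can be studied one at a time.

Characteristic 2. The property proved is `IsStarUnitReducible`: a single symmetric $s$ makes $a-sc$
a unit. Over a division ring with involution, $a$ is altered by diagonal matrix units $E_{kk}$, each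
of which strictly shrinks its kernel. A quaternion algebra over a field is either a division ring or
$M_2$ with adjugation. Adjugation is transposition twisted by an alternating matrix; in
characteristic 2 that matrix is a symmetric permutation matrix, so the twist can be absorbed and the
division ring argument applies to the field. Over a local ring, $s$ is lifted from the residue field
and Nakayama's lemma shows that $a-sc$ is still a unit. At almost all places the data are integral
and $\beta$ is a unit, so $s$ and $(a-sc)^{-1}$ can be taken integral there, and the local solutions
form adelic ones. There are no Archimedean places to consider. The pair $(1,0)$ shows that length 0
does not suffice.

Other characteristics. Complete $(a,c)$ to a matrix $g$ with columns $(a,c)$ and $(b,d)$ that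
preserves the hyperbolic form. A division step multiplies $g$ by a matrix with rows $(0,1)$,
$(-1,s)$, of determinant 1, so a decomposition forces $\det g=1$ in any matrix representation in
which $x$ and $x^*$ have equal determinants (`HasStarEuclideanDecomposition.det_eq_one`). Over a
field that splits the quaternion algebra, the group of such $g$ is an orthogonal group and contains
elements of determinant $-1\neq 1$; an explicit one refutes the property
(`QuaternionAlgebra.not_isStarEuclidean_matrix`). Direct factors inherit the property, so one
splitting place is enough. The algebra splits where $X^2-X-\alpha$ has a root, in particular where
its discriminant $1+4\alpha$ is a square. To find such a place for a given $\delta\neq 0$, values of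
$\delta z^2-1$ that are not units of the ring of integers are produced by a norm argument, and
Hensel's lemma is applied at a prime dividing one of them. -/

open scoped Quaternion

/-! ### Standard presentation of a quaternion algebra and its base change -/

theorem IsSimpleRing.eq_zero_of_isTwoSided {H : Type*} [Ring H] [IsSimpleRing H] (S : AddSubgroup H) (hl : ∀ x, ∀ y ∈ S, x * y ∈ S)
    (hr : ∀ x ∈ S, ∀ y, x * y ∈ S) (h1 : (1 : H) ∉ S) : ∀ x ∈ S, x = 0 := by
  let I : TwoSidedIdeal H := TwoSidedIdeal.mk' (S : Set H) S.zero_mem (S.add_mem) (S.neg_mem)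
    (fun {x y} h ↦ hl x y h) (fun {x y} h ↦ hr x h y)
  have hI : ∀ x, x ∈ I ↔ x ∈ S := fun x ↦ by simp [I]
  rcases eq_bot_or_eq_top I with h | h
  · intro x hx
    rw [← hI, h] at hx
    simpa using hx
  · exact absurd ((hI 1).1 (h ▸ trivial)) h1

namespace IsQuaternionAlgebra

variable {F H : Type*} [Field F] [Ring H] [Algebra F H] [IsQuaternionAlgebra F H]

theorem exists_not_scalar : ∃ x : H, ∀ c : F, x ≠ algebraMap F H c := by
  by_contra! h
  have h4 : Module.finrank F H = 4 := finrank_eq_four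
  have h1 : Module.finrank F H = 1 := by
    rw [Algebra.finrank_eq_one_iff_bijective_algebraMap]
    exact ⟨(algebraMap F H).injective, fun x ↦ (h x).imp fun _ hc ↦ hc.symm⟩
  omega

/-- If all pure elements squared to zero, polarisation would make them anticommute, so a product of
two would again be pure. As $H$ is the sum of $F$ and the pure elements when 2 is invertible, these
would form a two-sided ideal without 1, hence vanish, and $H$ would equal $F$. -/
theorem exists_pure_sq_ne_zero (h2 : (2 : F) ≠ 0) {σ : H →ₗ[F] H} (hσ : IsCanonicalInvolution σ) :
    ∃ x : H, σ x = -x ∧ x * x ≠ 0 := by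
  by_contra! h
  have anti : ∀ x y : H, σ x = -x → σ y = -y → x * y = -(y * x) := by
    intro x y hx hy
    have h3 := h (x + y) (by rw [map_add, hx, hy]; abel)
    rw [mul_add, add_mul, add_mul, h x hx, h y hy, zero_add, add_zero] at h3
    exact eq_neg_of_add_eq_zero_right h3
  have dec : ∀ x : H, ∃ (c : F) (y : H), σ y = -y ∧ x = algebraMap F H c + y := by
    intro x
    obtain ⟨c, hc⟩ := hσ.add_self_mem x
    have hs : σ x = algebraMap F H c - x := by rw [← hc]; abel
    have hcc : algebraMap F H (2⁻¹ * c) + algebraMap F H (2⁻¹ * c) = algebraMap F H c := by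
      rw [← map_add]; congr 1; field_simp; ring
    refine ⟨2⁻¹ * c, x - algebraMap F H (2⁻¹ * c), ?_, by abel⟩
    rw [map_sub, hσ.map_algebraMap, hs, ← hcc]
    abel
  let S : AddSubgroup H :=
    { carrier := {x | σ x = -x}
      zero_mem' := by simp
      add_mem' := fun {x y} hx hy ↦ by
        simp only [Set.mem_ofPred_eq] at *
        rw [map_add, hx, hy]; abel
      neg_mem' := fun {x} hx ↦ by
        simp only [Set.mem_ofPred_eq] at *
        rw [map_neg, hx] }
  have hS : ∀ x, x ∈ S ↔ σ x = -x := fun x ↦ Iff.rfl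
  have hpp : ∀ x y : H, σ x = -x → σ y = -y → σ (x * y) = -(x * y) := by
    intro x y hx hy
    rw [hσ.map_mul_rev, hx, hy, neg_mul_neg, anti x y hx hy, neg_neg]
  have hsp : ∀ (c : F) (x : H), σ x = -x → σ (algebraMap F H c * x) = -(algebraMap F H c * x) := by
    intro c x hx
    rw [← Algebra.smul_def, map_smul, hx, smul_neg]
  have : IsSimpleRing H := IsQuaternionAlgebra.toIsSimpleRing F
  have h0 := IsSimpleRing.eq_zero_of_isTwoSided S (by
    intro x y hy
    obtain ⟨c, z, hz, rfl⟩ := dec x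
    rw [add_mul]
    exact S.add_mem (hsp c y hy) (hpp z y hz hy)) (by
    intro x hx y
    obtain ⟨c, z, hz, rfl⟩ := dec y
    rw [mul_add, ← Algebra.commutes]
    exact S.add_mem (hsp c x hx) (hpp x z hx hz)) (by
    rw [hS, hσ.map_one]
    intro h1
    apply h2
    apply (algebraMap F H).injective
    rw [map_zero, ← one_add_one_eq_two, map_add, map_one]
    nth_rw 1 [h1]; simp)
  obtain ⟨x, hx⟩ := exists_not_scalar (F := F) (H := H)
  obtain ⟨c, y, hy, rfl⟩ := dec x
  exact hx c (by rw [h0 y hy, add_zero])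

/-- In characteristic 2 some trace is nonzero, since otherwise $\sigma=\mathrm{id}$ and $H$ would be
commutative; rescaling makes the trace 1. In other characteristics $u=(1+x)/2$ with $x$ pure and
$x^2\neq0$, and then $1+4\alpha=x^2$. -/
theorem exists_trace_one {σ : H →ₗ[F] H} (hσ : IsCanonicalInvolution σ) :
    ∃ (u : H) (α : F), σ u = 1 - u ∧ u * u = algebraMap F H α + u ∧ 1 + 4 * α ≠ 0 ∧
      ∀ c : F, u ≠ algebraMap F H c := by
  by_cases h2 : (2 : F) = 0
  · have hneg : ∀ x : H, -x = x := fun x ↦ by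
      have : (2 : F) • x = 0 := by rw [h2, zero_smul]
      rw [two_smul] at this
      exact neg_eq_of_add_eq_zero_left this
    have hT : ∃ x : H, x + σ x ≠ 0 := by
      by_contra! h
      have hid : ∀ x, σ x = x := fun x ↦ by
        rw [← hneg x]; exact (neg_eq_of_add_eq_zero_right (by rw [hneg, h])).symm
      obtain ⟨x, hx⟩ := exists_not_scalar (F := F) (H := H)
      have : x ∈ Subalgebra.center F H := by
        rw [Subalgebra.mem_center_iff]
        intro b
        have := hσ.map_mul_rev b x
        rw [hid, hid, hid] at this
        exact this
      obtain ⟨c, hc⟩ := Algebra.mem_bot.1 (Algebra.IsCentral.out this)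
      exact hx c hc.symm
    obtain ⟨x, hx⟩ := hT
    obtain ⟨t, ht⟩ := hσ.add_self_mem x
    have ht0 : t ≠ 0 := by rintro rfl; exact hx (by rw [ht, map_zero])
    have hu : σ (t⁻¹ • x) = 1 - t⁻¹ • x := by
      rw [map_smul, eq_sub_iff_add_eq, ← smul_add, add_comm, ht, Algebra.smul_def, ← map_mul,
        inv_mul_cancel₀ ht0, map_one]
    obtain ⟨m, hm⟩ := hσ.mul_self_mem (t⁻¹ • x)
    refine ⟨t⁻¹ • x, -m, hu, ?_, ?_, ?_⟩
    · rw [map_neg, ← hm, hu, mul_sub, mul_one]; abel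
    · have : (4 : F) = 2 * 2 := by norm_num
      rw [this, h2]; simp
    · intro c hc
      rw [hc, hσ.map_algebraMap, eq_sub_iff_add_eq, ← map_add, ← two_mul, h2, zero_mul,
        map_zero] at hu
      exact zero_ne_one hu
  · obtain ⟨x, hx, hxx⟩ := exists_pure_sq_ne_zero h2 hσ
    obtain ⟨m, hm⟩ := hσ.mul_self_mem x
    rw [hx, mul_neg] at hm
    have hxm : x * x = algebraMap F H (-m) := by rw [map_neg, ← hm, neg_neg]
    have hm0 : m ≠ 0 := by rintro rfl; exact hxx (by rw [hxm]; simp)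
    have h4 : (4 : F) = 2 * 2 := by norm_num
    have hhalf : (2⁻¹ : F) + 2⁻¹ = 1 := by field_simp; norm_num
    refine ⟨(2⁻¹ : F) • (1 + x), 4⁻¹ * (-m - 1), ?_, ?_, ?_, ?_⟩
    · rw [map_smul, map_add, hσ.map_one, hx, eq_sub_iff_add_eq, ← smul_add]
      have : (1 + -x + (1 + x)) = (2 : F) • (1 : H) := by rw [two_smul]; abel
      rw [this, smul_smul, inv_mul_cancel₀ h2, one_smul]
    · rw [smul_mul_smul_comm, mul_add, add_mul, add_mul, hxm]
      simp only [Algebra.algebraMap_eq_smul_one, mul_one, one_mul]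
      rw [h4]
      match_scalars <;> field_simp <;> ring
    · rw [h4]; field_simp; simpa using hm0
    · intro c hc
      have h3 : x = algebraMap F H (2 * c - 1) := by
        have : x = (2 : F) • ((2⁻¹ : F) • (1 + x)) - 1 := by
          rw [smul_smul, mul_inv_cancel₀ h2, one_smul]; abel
        rw [this, hc, map_sub, map_mul, map_one, Algebra.smul_def]
      rw [h3, hσ.map_algebraMap, ← map_neg] at hx
      have h5 := (algebraMap F H).injective hx
      have h6 : (2 : F) * (2 * c - 1) = 0 := by linear_combination h5
      have h7 := (mul_eq_zero.1 h6).resolve_left h2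
      rw [h7, map_zero] at h3
      exact hxx (by rw [h3, mul_zero])

/-- Every commutator $j=ux-xu$ satisfies all the identities; only $j^2\neq0$ is in question. If all
these commutators squared to zero, they would form a proper two-sided ideal, hence vanish, and $u$
would be central. -/
theorem exists_anticommuting {σ : H →ₗ[F] H} (hσ : IsCanonicalInvolution σ) {u : H} {α : F}
    (hu : σ u = 1 - u) (huu : u * u = algebraMap F H α + u) (hα : 1 + 4 * α ≠ 0)
    (hF : ∀ c : F, u ≠ algebraMap F H c) :
    ∃ (j : H) (β : F), σ j = -j ∧ j * j = algebraMap F H β ∧ j * u = (1 - u) * j ∧ β ≠ 0 := by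
  have hju : ∀ x, (u * x - x * u) * u = (1 - u) * (u * x - x * u) := by
    intro x
    have e1 : (u * x - x * u) * u = u * x * u - x * (u * u) := by noncomm_ring
    have e2 : (1 - u) * (u * x - x * u) = u * x - x * u - (u * u) * x + u * x * u := by noncomm_ring
    rw [e1, e2, huu, mul_add, add_mul, ← Algebra.commutes]
    abel
  have hσj : ∀ x, σ (u * x - x * u) = -(u * x - x * u) := by
    intro x
    obtain ⟨t, ht⟩ := hσ.add_self_mem x
    have hx : σ x = algebraMap F H t - x := by rw [← ht]; abel
    rw [map_sub, hσ.map_mul_rev, hσ.map_mul_rev, hu, hx]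
    simp only [mul_sub, sub_mul, mul_one, one_mul, Algebra.commutes]
    abel
  have hjj : ∀ x, ∃ β : F, (u * x - x * u) * (u * x - x * u) = algebraMap F H β := by
    intro x
    obtain ⟨m, hm⟩ := hσ.mul_self_mem (u * x - x * u)
    refine ⟨-m, ?_⟩
    rw [map_neg, ← hm, hσj, mul_neg, neg_neg]
  by_contra! h
  have hsq : ∀ x, (u * x - x * u) * (u * x - x * u) = 0 := by
    intro x
    obtain ⟨β, hβ⟩ := hjj x
    rw [hβ, h _ β (hσj x) hβ (hju x), map_zero]
  let D : H →ₗ[F] H := LinearMap.mulLeft F u - LinearMap.mulRight F u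
  have hD : ∀ x, D x = u * x - x * u := fun x ↦ by simp [D]
  simp only [← hD] at hju hσj hsq
  have hanti : ∀ x y, D x * D y = -(D y * D x) := by
    intro x y
    have h3 := hsq (x + y)
    rw [map_add, mul_add, add_mul, add_mul, hsq x, hsq y, zero_add, add_zero] at h3
    exact eq_neg_of_add_eq_zero_right h3
  have huD : ∀ x, u * D x = D (u * x) := fun x ↦ by rw [hD, hD]; noncomm_ring
  have hdisc : (1 - 2 * u) * (1 - 2 * u) = algebraMap F H (1 + 4 * α) := by
    have : (1 - 2 * u) * (1 - 2 * u) = 1 - 4 * u + 4 * (u * u) := by noncomm_ring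
    rw [this, huu, map_add, map_mul, map_one, map_ofNat]
    noncomm_ring
  have hinv : ∀ x, (algebraMap F H (1 + 4 * α)⁻¹ * (1 - 2 * u)) * ((1 - 2 * u) * x) = x := by
    intro x
    rw [mul_assoc, ← mul_assoc (1 - 2 * u), hdisc, ← mul_assoc, ← map_mul, inv_mul_cancel₀ hα, map_one, one_mul]
  have hDD : ∀ x y, D x * D y = 0 := by
    intro x y
    -- Anticommutation of $Dx$ with $D(uy)=u\,Dy$, compared with $Dx\,u=(1-u)Dx$, gives
    -- $(1-2u)\,Dx\,Dy=0$, and $1-2u$ is invertible.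
    have h3 := hanti x (u * y)
    rw [← huD, ← mul_assoc, hju, mul_assoc, mul_assoc, hanti y x] at h3
    have h4 : (1 - 2 * u) * (D x * D y) = 0 := by
      have : (1 - 2 * u) * (D x * D y) = (1 - u) * (D x * D y) + u * -(D x * D y) := by
        noncomm_ring
      rw [this, h3]; simp
    have h5 := hinv (D x * D y)
    rw [h4, mul_zero] at h5
    exact h5.symm
  have hDDx : ∀ x, D (D x) = -((1 - 2 * u) * D x) := by
    intro x
    rw [hD (D x), hju]; noncomm_ring
  have hcent : ∀ c x, D c = 0 → c * D x = D (c * x) ∧ D x * c = D (x * c) := by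
    intro c x hc
    rw [hD, sub_eq_zero] at hc
    rw [hD, hD, hD]
    constructor
    · rw [mul_sub, ← mul_assoc, ← hc]; noncomm_ring
    · rw [sub_mul, mul_assoc x u c, hc]; noncomm_ring
  have hcomm2 : ∀ x, (1 - 2 * u) * D x = D ((1 - 2 * u) * x) := by
    intro x; rw [hD, hD]; noncomm_ring
  -- Since $D^2=-(1-2u)D$ and $(1-2u)^2=1+4\alpha$, the map $D$ is invertible on its image, so $H$
  -- is the centralizer of $u$ plus the image of $D$. The centralizer preserves that image and the
  -- image multiplies to zero with itself, which makes it an ideal.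
  have hdec : ∀ x, ∃ c y, D c = 0 ∧ x = c + D y := by
    intro x
    let y := -(algebraMap F H (1 + 4 * α)⁻¹ * ((1 - 2 * u) * x))
    refine ⟨x - D y, y, ?_, by abel⟩
    have hy : D y = -(algebraMap F H (1 + 4 * α)⁻¹ * ((1 - 2 * u) * D x)) := by
      simp only [y, map_neg, ← Algebra.smul_def, map_smul, hcomm2]
    rw [map_sub, hy, map_neg, ← Algebra.smul_def, map_smul, ← hcomm2, hDDx, mul_neg, smul_neg,
      neg_neg, Algebra.smul_def, ← mul_assoc, hinv, sub_self]
  have : IsSimpleRing H := IsQuaternionAlgebra.toIsSimpleRing F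
  have h0 := IsSimpleRing.eq_zero_of_isTwoSided (LinearMap.range D).toAddSubgroup (by
    rintro x _ ⟨y, rfl⟩
    obtain ⟨c, z, hc, rfl⟩ := hdec x
    exact ⟨c * y, by rw [add_mul, hDD, add_zero, (hcent c y hc).1]⟩) (by
    rintro _ ⟨y, rfl⟩ x
    obtain ⟨c, z, hc, rfl⟩ := hdec x
    exact ⟨y * c, by rw [mul_add, hDD, add_zero, (hcent c y hc).2]⟩) (by
    rintro ⟨y, hy⟩
    have := hsq y
    rw [hy, mul_one] at this
    exact one_ne_zero this)
  have hu' : u ∈ Subalgebra.center F H := by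
    rw [Subalgebra.mem_center_iff]
    intro b
    have := h0 (D b) ⟨b, rfl⟩
    rw [hD, sub_eq_zero] at this
    exact this.symm
  obtain ⟨c, hc⟩ := Algebra.mem_bot.1 (Algebra.IsCentral.out hu')
  exact hF c hc.symm

/-- Every quaternion algebra is generated by `i`, `j` with `i² = α + i`, `j² = β`, `j i = (1 - i) j`,
where `β` and the discriminant `1 + 4 α` of `X² - X - α` are nonzero. -/
theorem exists_algEquiv (F H : Type*) [Field F] [Ring H] [Algebra F H] [IsQuaternionAlgebra F H] :
    ∃ (α β : F) (e : ℍ[F,α,1,β] ≃ₐ[F] H), β ≠ 0 ∧ 1 + 4 * α ≠ 0 ∧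
      ∀ x, canonicalInvolution F H (e x) = e (star x) := by
  have hσ := isCanonicalInvolution_canonicalInvolution F H
  set σ := canonicalInvolution F H
  obtain ⟨u, α, hu, huu, hα, hF⟩ := exists_trace_one hσ
  obtain ⟨j, β, hj, hjj, hju, hβ⟩ := exists_anticommuting hσ hu huu hα hF
  let q : QuaternionAlgebra.Basis H α 1 β :=
    { i := u
      j := j
      k := u * j
      i_mul_i := by rw [huu, Algebra.algebraMap_eq_smul_one, one_smul]
      j_mul_j := by rw [hjj, Algebra.algebraMap_eq_smul_one]
      i_mul_j := rfl
      j_mul_i := by rw [hju, one_smul, sub_mul, one_mul] }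
  let f : ℍ[F,α,1,β] →ₐ[F] H := QuaternionAlgebra.lift q
  have hf : ∀ x, f x = algebraMap F H x.re + x.imI • u + x.imJ • j + x.imK • (u * j) := fun x ↦ rfl
  have hind : ∀ a b : F, algebraMap F H a + b • u = 0 → a = 0 ∧ b = 0 := by
    intro a b hab
    have hb : b = 0 := by
      by_contra hb
      apply hF (-(b⁻¹ * a))
      have h1 : b • u = -algebraMap F H a := (neg_eq_of_add_eq_zero_right hab).symm
      have h2 : u = b⁻¹ • (b • u) := by rw [smul_smul, inv_mul_cancel₀ hb, one_smul]
      rw [h2, h1, smul_neg, Algebra.smul_def, ← map_mul, map_neg]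
    subst hb
    simpa using hab
  have hinj : Function.Injective f := by
    rw [injective_iff_map_eq_zero]
    intro x hx
    rw [hf] at hx
    have hcom : ∀ y : H, y = 0 → u * y - y * u = 0 := by rintro _ rfl; simp
    have h1 := hcom _ hx
    -- Commuting with $u$ kills the coordinates along $1$ and $u$ and isolates the $j$-part;
    -- multiplying by $2u-1$ and by $j$ then leaves the scalar factor $(1+4\alpha)\beta\neq0$.
    have e1 : u * (algebraMap F H x.re + x.imI • u + x.imJ • j + x.imK • (u * j)) -
        (algebraMap F H x.re + x.imI • u + x.imJ • j + x.imK • (u * j)) * u =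
        (2 * u - 1) * ((algebraMap F H x.imJ + x.imK • u) * j) := by
      simp only [Algebra.algebraMap_eq_smul_one]
      simp only [mul_add, add_mul, mul_smul_comm, smul_mul_assoc, mul_assoc, hju, sub_mul, mul_sub,
        one_mul, mul_one, two_mul]
      module
    rw [e1] at h1
    have hdisc : (2 * u - 1) * (2 * u - 1) = algebraMap F H (1 + 4 * α) := by
      have : (2 * u - 1) * (2 * u - 1) = 1 - 4 * u + 4 * (u * u) := by noncomm_ring
      rw [this, huu, map_add, map_mul, map_one, map_ofNat]
      noncomm_ring
    have h2 : (1 + 4 * α) • (β • (algebraMap F H x.imJ + x.imK • u)) = 0 := by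
      have h3 : (2 * u - 1) * ((2 * u - 1) * ((algebraMap F H x.imJ + x.imK • u) * j)) * j = 0 := by
        rw [h1]; simp
      rw [← mul_assoc, hdisc, mul_assoc, mul_assoc, hjj, ← Algebra.commutes β, ← Algebra.smul_def,
        ← Algebra.smul_def] at h3
      exact h3
    have h3 := (smul_eq_zero.1 ((smul_eq_zero.1 h2).resolve_left hα)).resolve_left hβ
    obtain ⟨hJ, hK⟩ := hind _ _ h3
    rw [hJ, hK, zero_smul, zero_smul, add_zero, add_zero] at hx
    obtain ⟨hR, hI⟩ := hind _ _ hx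
    exact QuaternionAlgebra.ext hR hI hJ hK
  have hfd : FiniteDimensional F H := FiniteDimensional.of_finrank_pos
    (by rw [finrank_eq_four (F := F) (H := H)]; norm_num)
  have hsurj : Function.Surjective f :=
    (LinearMap.injective_iff_surjective_of_finrank_eq_finrank (f := f.toLinearMap) (by
      rw [QuaternionAlgebra.finrank_eq_four, finrank_eq_four])).1 hinj
  have hbij : Function.Bijective f := ⟨hinj, hsurj⟩
  refine ⟨α, β, AlgEquiv.ofBijective f hbij, hβ, hα, fun x ↦ ?_⟩
  rw [AlgEquiv.coe_ofBijective, hf, hf]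
  simp only [map_add, map_smul, hσ.map_algebraMap, hu, hj, hσ.map_mul_rev, QuaternionAlgebra.re_star,
    QuaternionAlgebra.imI_star, QuaternionAlgebra.imJ_star, QuaternionAlgebra.imK_star]
  have : -j * (1 - u) = -(u * j) := by
    rw [mul_sub, neg_mul, neg_mul, hju]; noncomm_ring
  rw [this]
  simp only [Algebra.algebraMap_eq_smul_one]
  module

end IsQuaternionAlgebra

namespace QuaternionAlgebra

/-- The map of quaternion algebras induced by a homomorphism of the coefficient rings. -/
@[simps]
def mapRingHom {R S : Type*} [CommRing R] [CommRing S] (f : R →+* S) {a c : R} {a' c' : S}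
    (ha : f a = a') (hc : f c = c') : ℍ[R,a,1,c] →+* ℍ[S,a',1,c'] where
  toFun x := ⟨f x.re, f x.imI, f x.imJ, f x.imK⟩
  map_one' := by ext <;> simp
  map_zero' := by ext <;> simp
  map_add' x y := by ext <;> simp
  map_mul' x y := by ext <;> simp [← ha, ← hc]

theorem mapRingHom_star {R S : Type*} [CommRing R] [CommRing S] (f : R →+* S) {a c : R} {a' c' : S}
    (ha : f a = a') (hc : f c = c') (x : ℍ[R,a,1,c]) :
    mapRingHom f ha hc (star x) = star (mapRingHom f ha hc x) := by
  ext <;> simp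

/-- Base change of a quaternion algebra. -/
theorem exists_tensorProduct_ringEquiv {F H : Type*} [Field F] [Ring H] [Algebra F H] {α β : F}
    (e : ℍ[F,α,1,β] ≃ₐ[F] H) (σ : H →ₗ[F] H) (hσ : ∀ x, σ (e x) = e (star x))
    (R : Type*) [CommRing R] [Algebra F R] :
    ∃ E : H ⊗[F] R ≃+* ℍ[R,algebraMap F R α,1,algebraMap F R β],
      ∀ z, E (σ.rTensor R z) = star (E z) := by
  let f₀ : ℍ[F,α,1,β] →ₐ[F] ℍ[R,algebraMap F R α,1,algebraMap F R β] :=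
    { mapRingHom (algebraMap F R) rfl rfl with
      commutes' := fun c ↦ by ext <;> simp [IsScalarTower.algebraMap_apply F R ℍ[R,_,_,_],
        QuaternionAlgebra.algebraMap_eq] }
  let g₀ : R →ₐ[F] ℍ[R,algebraMap F R α,1,algebraMap F R β] :=
    IsScalarTower.toAlgHom F R _
  have hf₀ : ∀ x, f₀ x = ⟨algebraMap F R x.re, algebraMap F R x.imI, algebraMap F R x.imJ,
    algebraMap F R x.imK⟩ := fun x ↦ rfl
  have hg₀ : ∀ r, g₀ r = algebraMap R _ r := fun r ↦ rfl
  let E₀ := Algebra.TensorProduct.lift (f₀.comp e.symm.toAlgHom) g₀ (fun x r ↦ by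
    rw [hg₀]; exact (Algebra.commutes r _).symm)
  have hE₀ : ∀ x r, E₀ (e x ⊗ₜ r) = ⟨r * algebraMap F R x.re, r * algebraMap F R x.imI,
      r * algebraMap F R x.imJ, r * algebraMap F R x.imK⟩ := by
    intro x r
    simp only [E₀, Algebra.TensorProduct.lift_tmul]
    have : (f₀.comp e.symm.toAlgHom) (e x) = f₀ x := by simp
    rw [this, hg₀, ← Algebra.commutes, ← Algebra.smul_def, hf₀, QuaternionAlgebra.smul_mk]
    simp
  let G : ℍ[R,algebraMap F R α,1,algebraMap F R β] →+ H ⊗[F] R :=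
    { toFun := fun x ↦ e ⟨1, 0, 0, 0⟩ ⊗ₜ x.re + e ⟨0, 1, 0, 0⟩ ⊗ₜ x.imI + e ⟨0, 0, 1, 0⟩ ⊗ₜ x.imJ
        + e ⟨0, 0, 0, 1⟩ ⊗ₜ x.imK
      map_zero' := by simp
      map_add' := fun x y ↦ by simp only [re_add, imI_add, imJ_add, imK_add, TensorProduct.tmul_add]; abel }
  have hG : ∀ x, G x = e ⟨1, 0, 0, 0⟩ ⊗ₜ x.re + e ⟨0, 1, 0, 0⟩ ⊗ₜ x.imI + e ⟨0, 0, 1, 0⟩ ⊗ₜ x.imJ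
        + e ⟨0, 0, 0, 1⟩ ⊗ₜ x.imK := fun x ↦ rfl
  have hGE : ∀ z, G (E₀ z) = z := by
    intro z
    induction z with
    | zero => simp
    | add x y hx hy => rw [map_add, map_add, hx, hy]
    | tmul h r =>
      obtain ⟨x, rfl⟩ := e.surjective h
      rw [hE₀, hG]
      simp only [mul_comm r, ← Algebra.smul_def, ← TensorProduct.smul_tmul, ← map_smul,
        ← TensorProduct.add_tmul, ← map_add]
      congr 2
      ext <;> simp
  have hEG : ∀ x, E₀ (G x) = x := by
    intro x
    rw [hG]
    simp only [map_add, hE₀]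
    ext <;> simp
  refine ⟨RingEquiv.ofBijective E₀ ⟨Function.LeftInverse.injective hGE,
    Function.RightInverse.surjective hEG⟩, fun z ↦ ?_⟩
  change E₀ _ = star (E₀ z)
  induction z with
  | zero => simp
  | add x y hx hy => rw [map_add, map_add, map_add, hx, hy, star_add]
  | tmul h r =>
    obtain ⟨x, rfl⟩ := e.surjective h
    rw [LinearMap.rTensor_tmul, hσ, hE₀, hE₀]
    ext <;> simp [mul_add]

end QuaternionAlgebra

/-! ### Admissible pairs, reduction in one step, and direct factors -/

theorem isStarCoprimePair_iff {A : Type*} [Ring A] [StarRing A] (a c : A) :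
    IsStarCoprimePair a c ↔ (∃ u w : A, u * a + w * c = 1) ∧ IsSelfAdjoint (star a * c) := by
  unfold IsStarCoprimePair
  refine and_congr_left fun _ ↦ ?_
  rw [Ideal.eq_top_iff_one, Submodule.mem_sup]
  simp only [Ideal.mem_span_singleton']
  constructor
  · rintro ⟨_, ⟨u, rfl⟩, _, ⟨w, rfl⟩, h⟩
    exact ⟨u, w, h⟩
  · rintro ⟨u, w, h⟩
    exact ⟨_, ⟨u, rfl⟩, _, ⟨w, rfl⟩, h⟩

/-- For each admissible pair `(a, c)` there is a symmetric `s` such that `a - s * c` is a unit. -/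
def IsStarUnitReducible (A : Type*) [Ring A] [StarRing A] : Prop :=
  ∀ a c : A, IsStarCoprimePair a c → ∃ s : A, IsSelfAdjoint s ∧ IsUnit (a - s * c)

theorem IsStarUnitReducible.of_ringEquiv {A B : Type*} [Ring A] [StarRing A] [Ring B] [StarRing B]
    (e : A ≃+* B) (he : ∀ x, e (star x) = star (e x)) (h : IsStarUnitReducible B) :
    IsStarUnitReducible A := by
  intro a c hac
  rw [isStarCoprimePair_iff] at hac
  obtain ⟨⟨u, w, huw⟩, hsa⟩ := hac
  obtain ⟨s, hs, hunit⟩ := h (e a) (e c) ((isStarCoprimePair_iff _ _).2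
    ⟨⟨e u, e w, by rw [← map_mul, ← map_mul, ← map_add, huw, map_one]⟩, by
      rw [← he, ← map_mul, isSelfAdjoint_iff, ← he, hsa.star_eq]⟩)
  refine ⟨e.symm s, ?_, ?_⟩
  · rw [isSelfAdjoint_iff]
    apply e.injective
    rw [he, e.apply_symm_apply, hs.star_eq]
  · have h1 := hunit.map e.symm
    rwa [map_sub, map_mul, e.symm_apply_apply, e.symm_apply_apply] at h1

theorem IsStarUnitReducible.hasStarEuclideanDecomposition {A : Type*} [Ring A] [StarRing A]
    (h : IsStarUnitReducible A) {a c : A} (hac : IsStarCoprimePair a c) :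
    HasStarEuclideanDecomposition a c 1 := by
  obtain ⟨s, hs, hu⟩ := h a c hac
  -- Only the values of `r` at 0, 1 and 2 matter, the unit being the value at 2.
  refine ⟨fun _ ↦ s, fun i ↦ if i = 0 then a else if i = 1 then c else a - s * c, by simp, by simp,
    fun i hi ↦ ?_, by simpa using hu⟩
  obtain rfl : i = 0 := by omega
  exact ⟨hs, by simp⟩

theorem IsStarUnitReducible.isStarEuclidean {A : Type*} [Ring A] [StarRing A]
    (h : IsStarUnitReducible A) : IsStarEuclidean A :=
  fun _ _ hac ↦ ⟨1, h.hasStarEuclideanDecomposition hac⟩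

theorem IsStarUnitReducible.isStarEuclideanOfLength {A : Type*} [Ring A] [StarRing A] [Nontrivial A]
    (h : IsStarUnitReducible A) : IsStarEuclideanOfLength A 1 := by
  refine ⟨fun _ _ hac ↦ h.hasStarEuclideanDecomposition hac, fun m hm ↦ ?_⟩
  by_contra! hlt
  obtain rfl : m = 0 := by omega
  -- A decomposition of length 0 requires the second entry of the pair to be a unit, which fails for
  -- $(1,0)$.
  obtain ⟨s, r, -, h1, -, hu⟩ := hm 1 0 ((isStarCoprimePair_iff _ _).2 ⟨⟨1, 0, by simp⟩, by simp⟩)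
  rw [zero_add, h1] at hu
  exact not_isUnit_zero hu

/-- `*`-Euclidean rings are inherited by direct factors. -/
theorem IsStarEuclidean.of_section {A B : Type*} [Ring A] [StarRing A] [Ring B] [StarRing B]
    (f : A →+* B) (hf : ∀ x, f (star x) = star (f x)) (i : B →ₙ+* A)
    (hi : ∀ x, i (star x) = star (i x)) (hfi : ∀ x, f (i x) = x) (h : IsStarEuclidean A) :
    IsStarEuclidean B := by
  intro a c hac
  rw [isStarCoprimePair_iff] at hac
  obtain ⟨⟨u, w, huw⟩, hsa⟩ := hac
  have h1 : ∀ x, i x * i 1 = i x := fun x ↦ by rw [← map_mul, mul_one]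
  have h1' : ∀ x, i 1 * i x = i x := fun x ↦ by rw [← map_mul, one_mul]
  -- The element `i 1` is the idempotent of the factor. The pair is padded by $(1,0)$ on the
  -- complementary part, which keeps it admissible; applying `f` to its decomposition discards the
  -- padding.
  obtain ⟨m, s, r, hr0, hr1, hr, hu⟩ := h (i a + (1 - i 1)) (i c) ((isStarCoprimePair_iff _ _).2 ⟨
    ⟨i u + (1 - i 1), i w, by
      have h2 : i u * i a + i w * i c = i 1 := by rw [← map_mul, ← map_mul, ← map_add, huw]
      have h3 : (i u + (1 - i 1)) * (i a + (1 - i 1)) + i w * i c =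
        (i u * i a + i w * i c) + (i u - i u * i 1) + (i a - i 1 * i a) + (1 - i 1 - (i 1 - i 1 * i 1)) := by
        noncomm_ring
      rw [h3, h1, h1', h1, h2]; abel⟩, by
    rw [star_add, star_sub, star_one, ← hi, ← hi, star_one, add_mul, sub_mul, one_mul, h1', sub_self,
      add_zero, ← map_mul, isSelfAdjoint_iff, ← hi, hsa.star_eq]⟩)
  refine ⟨m, fun k ↦ f (s k), fun k ↦ f (r k), ?_, ?_, fun k hk ↦ ⟨?_, ?_⟩, hu.map f⟩
  · simp [hr0, hfi]
  · simp [hr1, hfi]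
  · rw [isSelfAdjoint_iff, ← hf, (hr k hk).1.star_eq]
  · simpa using congrArg f (hr k hk).2

theorem IsStarEuclidean.of_ringEquiv {A B : Type*} [Ring A] [StarRing A] [Ring B] [StarRing B]
    (e : A ≃+* B) (he : ∀ x, e (star x) = star (e x)) (h : IsStarEuclidean A) :
    IsStarEuclidean B :=
  h.of_section (e : A →+* B) he (e.symm : B →ₙ+* A)
    (fun x ↦ e.injective (by simp [he])) (fun x ↦ by simp)

/-! ### Matrices over division rings with involution -/

theorem Matrix.mapMatrix_star {A B n : Type*} [Fintype n] [DecidableEq n] [Ring A] [StarRing A]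
    [Ring B] [StarRing B] (f : A →+* B) (hf : ∀ x, f (star x) = star (f x)) (M : Matrix n n A) :
    f.mapMatrix (star M) = star (f.mapMatrix M) := by
  ext i j; simp [Matrix.star_eq_conjTranspose, hf]

-- Column vectors form a right $D$-space, that is a module over `Dᵐᵒᵖ`, on which matrices act
-- linearly; in finite dimension an injective endomorphism is surjective, and preimages of the
-- standard vectors are the columns of a right inverse.
open Matrix in
theorem Matrix.isUnit_of_mulVec_injective {D ι : Type*} [DivisionRing D] [Fintype ι] [DecidableEq ι]
    (a : Matrix ι ι D) (h : ∀ x, a *ᵥ x = 0 → x = 0) : IsUnit a := by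
  let f : (ι → D) →ₗ[Dᵐᵒᵖ] (ι → D) :=
    { toFun := fun x ↦ a *ᵥ x
      map_add' := fun x y ↦ Matrix.mulVec_add a x y
      map_smul' := fun r x ↦ by simp [Matrix.mulVec_smul] }
  have hinj : Function.Injective f := by
    rw [injective_iff_map_eq_zero]; exact h
  have hfin : FiniteDimensional Dᵐᵒᵖ (ι → D) := by
    have : FiniteDimensional Dᵐᵒᵖ D := ⟨⟨{1}, by
      rw [eq_top_iff]
      intro x _
      rw [Finset.coe_singleton, Submodule.mem_span_singleton]
      exact ⟨MulOpposite.op x, by simp⟩⟩⟩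
    infer_instance
  have hsurj : Function.Surjective f := LinearMap.injective_iff_surjective.1 hinj
  choose b hb using fun j : ι ↦ hsurj (Pi.single j 1)
  refine IsUnit.of_mul_eq_one (Matrix.of fun i j ↦ b j i) ?_
  ext i j
  have := congrFun (hb j) i
  rw [Matrix.one_apply]
  simp only [f, LinearMap.coe_mk, AddHom.coe_mk, Matrix.mulVec, dotProduct] at this
  simp only [Matrix.mul_apply, Matrix.of_apply]
  rw [this, Pi.single_apply]

-- Induction on the dimension of $\ker a$. A nonzero $x\in\ker a$ has $cx\neq0$ by coprimality, and
-- subtracting $E_{kk}c$ from $a$, with $k$ a coordinate where $cx$ is nonzero, removes $x$ from the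
-- kernel without adding anything.
open Matrix in
theorem isStarUnitReducible_matrix_divisionRing (D ι : Type*) [DivisionRing D] [StarRing D]
    [Fintype ι] [DecidableEq ι] : IsStarUnitReducible (Matrix ι ι D) := by
  have hfin : FiniteDimensional Dᵐᵒᵖ (ι → D) := by
    have : FiniteDimensional Dᵐᵒᵖ D := ⟨⟨{1}, by
      rw [eq_top_iff]
      intro x _
      rw [Finset.coe_singleton, Submodule.mem_span_singleton]
      exact ⟨MulOpposite.op x, by simp⟩⟩⟩
    infer_instance
  let ker (a : Matrix ι ι D) : Submodule Dᵐᵒᵖ (ι → D) :=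
    { carrier := {x | a *ᵥ x = 0}
      zero_mem' := by simp
      add_mem' := fun {x y} hx hy ↦ by
        simp only [Set.mem_ofPred_eq] at *
        rw [Matrix.mulVec_add, hx, hy, add_zero]
      smul_mem' := fun r x hx ↦ by
        simp only [Set.mem_ofPred_eq] at *
        rw [Matrix.mulVec_smul, hx, smul_zero] }
  have hker : ∀ a x, x ∈ ker a ↔ a *ᵥ x = 0 := fun a x ↦ Iff.rfl
  have main : ∀ (d : ℕ) (a c : Matrix ι ι D), Module.finrank Dᵐᵒᵖ (ker a) = d →
      (∃ u w : Matrix ι ι D, u * a + w * c = 1) → IsSelfAdjoint (star a * c) →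
      ∃ s : Matrix ι ι D, IsSelfAdjoint s ∧ IsUnit (a - s * c) := by
    intro d
    induction d using Nat.strong_induction_on with
    | _ d ih =>
      rintro a c hd ⟨u, w, huw⟩ hsa
      by_cases hinj : ∀ x, a *ᵥ x = 0 → x = 0
      · exact ⟨0, IsSelfAdjoint.zero _, by simpa using Matrix.isUnit_of_mulVec_injective a hinj⟩
      push Not at hinj
      obtain ⟨x, hx, hx0⟩ := hinj
      have hcx : c *ᵥ x ≠ 0 := by
        intro h
        apply hx0
        rw [← Matrix.one_mulVec x, ← huw, Matrix.add_mulVec, ← Matrix.mulVec_mulVec,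
          ← Matrix.mulVec_mulVec, hx, h, Matrix.mulVec_zero, Matrix.mulVec_zero, add_zero]
      obtain ⟨k, hk⟩ : ∃ k, (c *ᵥ x) k ≠ 0 := by
        by_contra! h
        exact hcx (funext h)
      have hsa' : star c * a = star a * c := by
        have := hsa.star_eq
        rwa [star_mul, star_star] at this
      let s : Matrix ι ι D := Matrix.single k k 1
      have hs : IsSelfAdjoint s := by
        rw [isSelfAdjoint_iff, Matrix.star_eq_conjTranspose, Matrix.conjTranspose_single, star_one]
      have hsv : ∀ v, s *ᵥ v = Pi.single k (v k) := by
        intro v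
        rw [Matrix.single_mulVec, one_mul]
        rfl
      have hle : ∀ v, (a - s * c) *ᵥ v = 0 → a *ᵥ v = 0 ∧ (c *ᵥ v) k = 0 := by
        intro v hv
        rw [Matrix.sub_mulVec, ← Matrix.mulVec_mulVec, hsv, sub_eq_zero] at hv
        -- Symmetry of $a^*c$ gives $\langle cx,av\rangle=\langle ax,cv\rangle=0$. As
        -- $av=e_k(cv)_k$, the pairing is also $(cx)_k^*(cv)_k$, whence $(cv)_k=0$ and $av=0$.
        have h1 : star (c *ᵥ x) ⬝ᵥ (a *ᵥ v) = 0 := by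
          rw [Matrix.star_mulVec, ← Matrix.dotProduct_mulVec, Matrix.mulVec_mulVec,
            ← Matrix.star_eq_conjTranspose, hsa', ← Matrix.mulVec_mulVec, Matrix.star_eq_conjTranspose,
            Matrix.dotProduct_mulVec, ← Matrix.star_mulVec, hx, star_zero, zero_dotProduct]
        rw [hv, dotProduct_single, mul_eq_zero] at h1
        have h2 := h1.resolve_left (by simpa using hk)
        rw [h2, Pi.single_zero] at hv
        exact ⟨hv, h2⟩
      have hlt : ker (a - s * c) < ker a := by
        refine lt_of_le_of_ne (fun v hv ↦ (hle v hv).1) fun heq ↦ hk ?_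
        have : x ∈ ker (a - s * c) := by rw [heq]; exact hx
        exact (hle x this).2
      -- The pair $(a-sc,c)$ is again admissible because $c^*sc$ is symmetric.
      obtain ⟨t, ht, hu⟩ := ih _ (hd ▸ Submodule.finrank_lt_finrank_of_lt hlt) (a - s * c) c rfl
        ⟨u, w + u * s, by rw [← huw]; noncomm_ring⟩ (by
          rw [star_sub, star_mul, hs.star_eq, sub_mul]
          refine hsa.sub ?_
          rw [isSelfAdjoint_iff, star_mul, star_mul, star_star, hs.star_eq, mul_assoc])
      exact ⟨s + t, hs.add ht, by rwa [add_mul, ← sub_sub]⟩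
  intro a c hac
  rw [isStarCoprimePair_iff] at hac
  exact main _ a c rfl hac.1 hac.2

open Matrix in
/-- In characteristic two the adjugation on `M₂` gives symplectic matrix involutions, which become
transposition after a twist by a symmetric permutation matrix. -/
theorem isStarUnitReducible_of_twist {A K ι : Type*} [Ring A] [StarRing A] [Field K] [Fintype ι]
    [DecidableEq ι] (e : A ≃+* Matrix ι ι K) (P : Matrix ι ι K) (hPt : Pᵀ = P) (hPP : P * P = 1)
    (he : ∀ x, e (star x) = P * (e x)ᵀ * P) : IsStarUnitReducible A := by
  intro a c hac
  rw [isStarCoprimePair_iff] at hac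
  obtain ⟨⟨u, w, huw⟩, hsa⟩ := hac
  -- With the trivial involution on $K$, the star of a matrix is its transpose.
  let _ : StarRing K := starRingOfComm
  have hst : ∀ M : Matrix ι ι K, star M = Mᵀ := fun M ↦ by
    ext i j; rfl
  have hPP' : ∀ M : Matrix ι ι K, P * (P * M) = M := fun M ↦ by rw [← mul_assoc, hPP, one_mul]
  have h1 : star (e a) * (P * e c) = P * e (star a * c) := by
    rw [map_mul, he, hst]
    simp only [mul_assoc, hPP']
  -- Replacing $c$ by $Pc$ turns the twisted symmetry condition into the one for transposition, and
  -- a solution $s$ for $(a,Pc)$ gives $sP$ for $(a,c)$.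
  obtain ⟨s, hs, hu⟩ := isStarUnitReducible_matrix_divisionRing K ι (e a) (P * e c)
    ((isStarCoprimePair_iff _ _).2 ⟨⟨e u, e w * P, by
      rw [mul_assoc, hPP', ← map_mul, ← map_mul, ← map_add, huw, map_one]⟩, by
      rw [h1, isSelfAdjoint_iff, hst, transpose_mul, hPt]
      conv_rhs => rw [← hsa.star_eq, he, mul_assoc, hPP']⟩)
  rw [isSelfAdjoint_iff, hst] at hs
  refine ⟨e.symm (s * P), ?_, ?_⟩
  · rw [isSelfAdjoint_iff]
    apply e.injective
    rw [he, e.apply_symm_apply, transpose_mul, hPt, hs, hPP']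
  · have h2 := hu.map e.symm
    rwa [map_sub, e.symm_apply_apply, ← mul_assoc, map_mul, e.symm_apply_apply] at h2

/-! ### Quaternion algebras over a field of characteristic two -/

namespace QuaternionAlgebra

theorem mul_star_eq_algebraMap {R : Type*} [CommRing R] {α β : R} (x : ℍ[R,α,1,β]) :
    x * star x = algebraMap R _ (x.re ^ 2 + x.re * x.imI - α * x.imI ^ 2
      - β * (x.imJ ^ 2 + x.imJ * x.imK - α * x.imK ^ 2)) := by
  ext <;> simp [QuaternionAlgebra.algebraMap_eq] <;> ring

theorem isUnit_of_norm_ne_zero {K : Type*} [Field K] {α β : K} (x : ℍ[K,α,1,β])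
    (h : x.re ^ 2 + x.re * x.imI - α * x.imI ^ 2
      - β * (x.imJ ^ 2 + x.imJ * x.imK - α * x.imK ^ 2) ≠ 0) : IsUnit x := by
  have h1 := mul_star_eq_algebraMap x
  have h2 := mul_star_eq_algebraMap (star x)
  rw [star_star] at h2
  have h3 : (star x).re ^ 2 + (star x).re * (star x).imI - α * (star x).imI ^ 2
      - β * ((star x).imJ ^ 2 + (star x).imJ * (star x).imK - α * (star x).imK ^ 2)
      = x.re ^ 2 + x.re * x.imI - α * x.imI ^ 2
      - β * (x.imJ ^ 2 + x.imJ * x.imK - α * x.imK ^ 2) := by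
    simp; ring
  rw [h3] at h2
  set N := x.re ^ 2 + x.re * x.imI - α * x.imI ^ 2
      - β * (x.imJ ^ 2 + x.imJ * x.imK - α * x.imK ^ 2)
  refine isUnit_iff_exists.2 ⟨N⁻¹ • star x, ?_, ?_⟩
  · rw [mul_smul_comm, h1, Algebra.smul_def, ← map_mul, inv_mul_cancel₀ h, map_one]
  · rw [smul_mul_assoc, h2, Algebra.smul_def, ← map_mul, inv_mul_cancel₀ h, map_one]

/-- In characteristic two, if `β` is not a norm from `K[X] / (X² - X - α)` then the quaternion
algebra is a division ring. -/
theorem isUnit_of_ne_zero {K : Type*} [Field K] (h2 : (2 : K) = 0) {α β : K}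
    (hβ : ∀ p q : K, β ≠ p ^ 2 + p * q - α * q ^ 2) (x : ℍ[K,α,1,β]) (hx : x ≠ 0) : IsUnit x := by
  have aniso : ∀ p q : K, p ^ 2 + p * q - α * q ^ 2 = 0 → p = 0 ∧ q = 0 := by
    intro p q h
    by_cases hq : q = 0
    · subst hq
      exact ⟨by simpa using h, rfl⟩
    · exfalso
      have hr : (p / q) ^ 2 + p / q - α = 0 := by
        field_simp; linear_combination h
      set r := p / q
      -- A root $r$ factors the form as $(p-rq)(p+(1+r)q)$; these values of $p,q$ make the factors
      -- $1$ and $\beta$ in characteristic 2.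
      refine hβ (1 + r * (β - 1)) (β - 1) ?_
      linear_combination (-(β - 1) ^ 2) * hr - r * (β - 1) * h2
  by_contra hu
  have hN : x.re ^ 2 + x.re * x.imI - α * x.imI ^ 2
      - β * (x.imJ ^ 2 + x.imJ * x.imK - α * x.imK ^ 2) = 0 := by
    by_contra h
    exact hu (isUnit_of_norm_ne_zero x h)
  by_cases hη : x.imJ ^ 2 + x.imJ * x.imK - α * x.imK ^ 2 = 0
  · rw [hη, mul_zero, sub_zero] at hN
    exact hx (QuaternionAlgebra.ext (aniso _ _ hN).1 (aniso _ _ hN).2 (aniso _ _ hη).1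
      (aniso _ _ hη).2)
  -- With $x=\xi+\eta j$, vanishing of the norm says $N(\xi)=\beta N(\eta)$, so $\beta$ is the norm
  -- of $\xi\bar\eta/N(\eta)$, whose coordinates are these.
  · refine hβ ((x.re * (x.imJ + x.imK) - α * x.imI * x.imK) /
      (x.imJ ^ 2 + x.imJ * x.imK - α * x.imK ^ 2)) ((x.imI * x.imJ - x.re * x.imK) /
      (x.imJ ^ 2 + x.imJ * x.imK - α * x.imK ^ 2)) ?_
    have h4 : β = (x.re ^ 2 + x.re * x.imI - α * x.imI ^ 2) /
        (x.imJ ^ 2 + x.imJ * x.imK - α * x.imK ^ 2) := by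
      rw [eq_div_iff hη]; linear_combination -hN
    refine h4.trans ?_
    generalize hn : x.imJ ^ 2 + x.imJ * x.imK - α * x.imK ^ 2 = n at hη
    field_simp
    rw [← hn]; ring

/-- In characteristic two, if `β ≠ 0` is a norm from `K[X] / (X² - X - α)` then the quaternion
algebra splits; the canonical involution becomes the adjugation. -/
theorem exists_ringEquiv_matrix {K : Type*} [Field K] (h2 : (2 : K) = 0) {α p q : K}
    {β : K} (hβ0 : β ≠ 0) (hβ : β = p ^ 2 + p * q - α * q ^ 2) :
    ∃ e : ℍ[K,α,1,β] ≃+* Matrix (Fin 2) (Fin 2) K,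
      ∀ x, e (star x) = !![e x 1 1, e x 0 1; e x 1 0, e x 0 0] := by
  -- Action on $K[\theta]$, $\theta^2=\alpha+\theta$, in the basis $1,\theta$: `i` is multiplication
  -- by $\theta$, and `j` is the conjugation $\theta\mapsto1+\theta$ followed by multiplication by
  -- $p+q\theta$, so its square is the norm $\beta$.
  let b : QuaternionAlgebra.Basis (Matrix (Fin 2) (Fin 2) K) α 1 β :=
    { i := !![0, α; 1, 1]
      j := !![p, p + α * q; q, p]
      k := !![α * q, α * p; p + q, p + α * q + p]
      i_mul_i := by
        ext i j; fin_cases i <;> fin_cases j <;> simp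
      j_mul_j := by
        ext i j; fin_cases i <;> fin_cases j <;> simp [hβ]
        · linear_combination α * q ^ 2 * h2
        · linear_combination p * (p + α * q) * h2
        · linear_combination p * q * h2
        · linear_combination α * q ^ 2 * h2
      i_mul_j := by
        ext i j; fin_cases i <;> fin_cases j <;> simp
      j_mul_i := by
        ext i j; fin_cases i <;> fin_cases j <;> simp
        · linear_combination α * q * h2
        · linear_combination (α * p + α * q) * h2 - α * q * h2
        · linear_combination p * h2
        · linear_combination α * q * h2 + p * h2 }
  let f := QuaternionAlgebra.lift b
  have hf : ∀ x, f x = algebraMap K _ x.re + x.imI • b.i + x.imJ • b.j + x.imK • b.k := fun x ↦ rfl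
  have hinj : Function.Injective f := by
    rw [injective_iff_map_eq_zero]
    intro x hx
    rw [hf] at hx
    have e00 := congrFun (congrFun hx 0) 0
    have e01 := congrFun (congrFun hx 0) 1
    have e10 := congrFun (congrFun hx 1) 0
    have e11 := congrFun (congrFun hx 1) 1
    simp [Matrix.algebraMap_matrix_apply, b] at e00 e01 e10 e11
    have hI : x.imI = 0 := by linear_combination e11 - e00 - x.imK * p * h2
    have hq : x.imJ * q + x.imK * (p + q) = 0 := by linear_combination e10 - hI
    have hp : x.imJ * p + x.imK * (α * q) = 0 := by
      linear_combination e01 - α * hI - α * hq + x.imK * α * q * h2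
    have hR : x.re = 0 := by linear_combination e00 - hp
    refine QuaternionAlgebra.ext hR hI ?_ ?_
    · refine (mul_eq_zero.1 (?_ : β * x.imJ = 0)).resolve_left hβ0
      linear_combination x.imJ * hβ + (p + q) * hp - α * q * hq
    · refine (mul_eq_zero.1 (?_ : β * x.imK = 0)).resolve_left hβ0
      linear_combination x.imK * hβ + p * hq - q * hp
  have hsurj : Function.Surjective f :=
    (LinearMap.injective_iff_surjective_of_finrank_eq_finrank (f := f.toLinearMap) (by
      rw [QuaternionAlgebra.finrank_eq_four, Module.finrank_matrix]; simp)).1 hinj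
  have hbij : Function.Bijective f := ⟨hinj, hsurj⟩
  refine ⟨RingEquiv.ofBijective f hbij, fun x ↦ ?_⟩
  change f (star x) = !![f x 1 1, f x 0 1; f x 1 0, f x 0 0]
  rw [hf, hf]
  ext i j; fin_cases i <;> fin_cases j <;> simp [Matrix.algebraMap_matrix_apply, b]
  · linear_combination (-x.imJ * p - x.imK * α * q - x.imK * p) * h2
  · linear_combination (-x.imI * α - x.imJ * (p + α * q) - x.imK * α * p) * h2
  · linear_combination (-x.imI - x.imJ * q - x.imK * (p + q)) * h2
  · linear_combination (-x.imJ * p - x.imK * α * q - x.imK * p) * h2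

end QuaternionAlgebra

/-- The matrix ring of a quaternion algebra over a field of characteristic two. -/
theorem isStarUnitReducible_matrix_quaternionAlgebra_field {K : Type*} [Field K] (h2 : (2 : K) = 0)
    {α β : K} (hβ : β ≠ 0) (ι : Type*) [Fintype ι] [DecidableEq ι] :
    IsStarUnitReducible (Matrix ι ι ℍ[K,α,1,β]) := by
  by_cases h : ∃ p q : K, β = p ^ 2 + p * q - α * q ^ 2
  · obtain ⟨p, q, hpq⟩ := h
    obtain ⟨e, he⟩ := QuaternionAlgebra.exists_ringEquiv_matrix h2 hβ hpq
    -- In characteristic 2 adjugation of a $2\times2$ matrix is its transpose conjugated by the swap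
    -- of the two coordinates; `τ` performs that swap in every block.
    let τ : ι × Fin 2 ≃ ι × Fin 2 := Equiv.prodCongr (Equiv.refl ι) (Equiv.swap 0 1)
    have hτ : ∀ x, τ (τ x) = x := fun x ↦ Prod.ext rfl (by simp [τ])
    have hτs : τ.symm = τ := Equiv.ext fun x ↦ by rw [Equiv.symm_apply_eq, hτ]
    refine isStarUnitReducible_of_twist (e.mapMatrix.trans (Matrix.compRingEquiv ι (Fin 2) K))
      (τ.toPEquiv.toMatrix) ?_ ?_ fun x ↦ ?_
    · rw [← PEquiv.toMatrix_symm, ← Equiv.toPEquiv_symm, hτs]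
    · rw [← PEquiv.toMatrix_trans, ← Equiv.toPEquiv_trans]
      have : τ.trans τ = Equiv.refl _ := Equiv.ext hτ
      rw [this, Equiv.toPEquiv_refl, PEquiv.toMatrix_refl]
    · rw [PEquiv.toMatrix_toPEquiv_mul, PEquiv.mul_toMatrix_toPEquiv, hτs]
      ext ⟨i, k⟩ ⟨j, l⟩
      have h1 := congrFun (congrFun (he (x j i)) k) l
      simp [Matrix.star_eq_conjTranspose, τ, h1]
      fin_cases k <;> fin_cases l <;> simp
  · push Not at h
    let _ : DivisionRing ℍ[K,α,1,β] := DivisionRing.ofIsUnitOrEqZero fun x ↦ by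
      by_cases hx : x = 0
      · exact Or.inr hx
      · exact Or.inl (QuaternionAlgebra.isUnit_of_ne_zero h2 h x hx)
    exact isStarUnitReducible_matrix_divisionRing ℍ[K,α,1,β] ι

/-! ### Lifting from the residue field of a local ring -/

section LocalRing

variable {O : Type*} [CommRing O] [IsLocalRing O] {α β : O} {ι : Type*} [Fintype ι] [DecidableEq ι]

open IsLocalRing

/-- Nakayama: left and right multiplication by $x$ are surjective modulo the maximal ideal, hence
surjective on the finite module $A$, which yields inverses on both sides. -/
theorem IsLocalRing.isUnit_of_exists_sub_mem_smul_top {A : Type*} [Ring A] [Algebra O A]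
    [Module.Finite O A] (x : A)
    (hr : ∃ y, x * y - 1 ∈ maximalIdeal O • (⊤ : Submodule O A))
    (hl : ∃ y, y * x - 1 ∈ maximalIdeal O • (⊤ : Submodule O A)) : IsUnit x := by
  have key : ∀ (f : A →ₗ[O] A), (∃ g : A →ₗ[O] A, ∀ z,
      f (g z) - z ∈ maximalIdeal O • (⊤ : Submodule O A)) → Function.Surjective f := by
    rintro f ⟨g, hg⟩
    rw [← LinearMap.range_eq_top, eq_top_iff]
    refine Submodule.le_of_le_smul_of_le_jacobson_bot (I := maximalIdeal O) Module.Finite.fg_top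
      (IsLocalRing.maximalIdeal_le_jacobson ⊥) fun z _ ↦ ?_
    rw [Submodule.mem_sup]
    exact ⟨f (g z), ⟨g z, rfl⟩, -(f (g z) - z), Submodule.neg_mem _ (hg z), by abel⟩
  have hmem : ∀ (h : A →ₗ[O] A) {y}, y ∈ maximalIdeal O • (⊤ : Submodule O A) →
      h y ∈ maximalIdeal O • (⊤ : Submodule O A) := by
    intro h y hy
    have := Submodule.mem_map_of_mem (f := h) hy
    rw [Submodule.map_smul''] at this
    exact Submodule.smul_mono le_rfl le_top this
  obtain ⟨y, hy⟩ := hr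
  obtain ⟨y', hy'⟩ := hl
  obtain ⟨u, hu⟩ := key (LinearMap.mulLeft O x) ⟨LinearMap.mulLeft O y, fun z ↦ by
    have := hmem (LinearMap.mulRight O z) hy
    simpa [sub_mul, mul_assoc] using this⟩ 1
  obtain ⟨w, hw⟩ := key (LinearMap.mulRight O x) ⟨LinearMap.mulRight O y', fun z ↦ by
    have := hmem (LinearMap.mulLeft O z) hy'
    simpa [mul_sub, mul_assoc] using this⟩ 1
  simp only [LinearMap.mulLeft_apply, LinearMap.mulRight_apply] at hu hw
  have : w = u := left_inv_eq_right_inv hw hu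
  exact isUnit_iff_exists.2 ⟨u, hu, this ▸ hw⟩

theorem Matrix.mem_smul_top_of_forall {O : Type*} [CommRing O] {α β : O} {ι : Type*} [Fintype ι]
    [DecidableEq ι] {I : Ideal O} (x : Matrix ι ι ℍ[O,α,1,β])
    (h : ∀ i j, (x i j).re ∈ I ∧ (x i j).imI ∈ I ∧ (x i j).imJ ∈ I ∧ (x i j).imK ∈ I) :
    x ∈ I • (⊤ : Submodule O (Matrix ι ι ℍ[O,α,1,β])) := by
  have hx : x = ∑ i, ∑ j, ((x i j).re • Matrix.single i j ⟨1, 0, 0, 0⟩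
      + (x i j).imI • Matrix.single i j ⟨0, 1, 0, 0⟩ + (x i j).imJ • Matrix.single i j ⟨0, 0, 1, 0⟩
      + (x i j).imK • Matrix.single i j ⟨0, 0, 0, 1⟩) := by
    conv_lhs => rw [Matrix.matrix_eq_sum_single x]
    refine Finset.sum_congr rfl fun i _ ↦ Finset.sum_congr rfl fun j _ ↦ ?_
    simp only [Matrix.smul_single, ← Matrix.single_add]
    congr 1
    ext <;> simp
  rw [hx]
  refine Submodule.sum_mem _ fun i _ ↦ Submodule.sum_mem _ fun j _ ↦ ?_
  obtain ⟨h1, h2, h3, h4⟩ := h i j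
  exact add_mem (add_mem (add_mem (Submodule.smul_mem_smul h1 trivial)
    (Submodule.smul_mem_smul h2 trivial)) (Submodule.smul_mem_smul h3 trivial))
    (Submodule.smul_mem_smul h4 trivial)

/-- The matrix ring of a quaternion algebra over a local ring of characteristic two. -/
theorem isStarUnitReducible_matrix_quaternionAlgebra_local (h2 : (2 : O) = 0) (hβ : IsUnit β) :
    IsStarUnitReducible (Matrix ι ι ℍ[O,α,1,β]) := by
  intro a c hac
  rw [isStarCoprimePair_iff] at hac
  obtain ⟨⟨u, w, huw⟩, hsa⟩ := hac
  let π := residue O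
  let q : ℍ[O,α,1,β] →+* ℍ[ResidueField O,π α,1,π β] := QuaternionAlgebra.mapRingHom π rfl rfl
  let Q := q.mapMatrix (m := ι)
  have hQ : ∀ x, Q (star x) = star (Q x) :=
    Matrix.mapMatrix_star q (QuaternionAlgebra.mapRingHom_star π rfl rfl)
  have h2' : (2 : ResidueField O) = 0 := by
    rw [← map_ofNat π, h2, map_zero]
  obtain ⟨s', hs', hu'⟩ := isStarUnitReducible_matrix_quaternionAlgebra_field h2'
    (α := π α) (hβ.map π).ne_zero ι (Q a) (Q c) ((isStarCoprimePair_iff _ _).2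
      ⟨⟨Q u, Q w, by rw [← map_mul, ← map_mul, ← map_add, huw, map_one]⟩, by
        rw [← hQ, ← map_mul, isSelfAdjoint_iff, ← hQ, hsa.star_eq]⟩)
  -- The normalisation $l(0)=0$ matters: in characteristic 2 a quaternion is symmetric exactly when
  -- its $i$-coordinate vanishes, so coordinatewise lifting keeps diagonal entries symmetric.
  have hl : ∃ l : ResidueField O → O, (∀ x, π (l x) = x) ∧ l 0 = 0 := by
    classical
    refine ⟨fun x ↦ if x = 0 then 0 else Function.surjInv residue_surjective x, fun x ↦ ?_, if_pos rfl⟩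
    by_cases hx : x = 0
    · simp [hx]
    · simp only [if_neg hx]; exact Function.surjInv_eq residue_surjective x
  obtain ⟨l, hl, hl0⟩ := hl
  let L : ℍ[ResidueField O,π α,1,π β] → ℍ[O,α,1,β] := fun x ↦ ⟨l x.re, l x.imI, l x.imJ, l x.imK⟩
  have hL : ∀ x, q (L x) = x := fun x ↦ by
    ext <;> simp [q, L, hl]
  have hneg : ∀ x : O, -x = x := fun x ↦ by linear_combination (-x) * h2
  have hLs : ∀ x, star x = x → star (L x) = L x := by
    intro x hx
    have hI : x.imI = 0 := by
      have := congrArg QuaternionAlgebra.re hx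
      simpa using this
    ext <;> simp [L, hI, hl0, hneg]
  have hQs : ∀ x : Matrix ι ι ℍ[ResidueField O,π α,1,π β], ∃ y, Q y = x :=
    fun x ↦ ⟨x.map L, Matrix.ext fun i j ↦ hL _⟩
  have hs : ∃ s : Matrix ι ι ℍ[O,α,1,β], IsSelfAdjoint s ∧ Q s = s' := by
    let k := Fintype.equivFin ι
    have hs'' : ∀ i j, star (s' i j) = s' j i := fun i j ↦ by
      conv_rhs => rw [← hs'.star_eq]
      rfl
    -- Entries on and above the diagonal are lifted freely and the others are forced by symmetry;
    -- the numbering `k` only serves to order the indices.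
    refine ⟨Matrix.of fun i j ↦ if k i ≤ k j then L (s' i j) else star (L (s' j i)), ?_, ?_⟩
    · rw [isSelfAdjoint_iff]
      refine Matrix.ext fun i j ↦ ?_
      rw [Matrix.star_eq_conjTranspose, Matrix.conjTranspose_apply, Matrix.of_apply, Matrix.of_apply]
      rcases lt_trichotomy (k i) (k j) with h | h | h
      · rw [if_neg (not_le.2 h), if_pos h.le, star_star]
      · obtain rfl := k.injective h
        rw [if_pos le_rfl, hLs _ (hs'' i i)]
      · rw [if_pos h.le, if_neg (not_le.2 h)]
    · refine Matrix.ext fun i j ↦ ?_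
      simp only [Q, RingHom.mapMatrix_apply, Matrix.map_apply, Matrix.of_apply]
      split_ifs
      · exact hL _
      · rw [QuaternionAlgebra.mapRingHom_star π rfl rfl, ← hs'' j i]
        exact congrArg star (hL _)
  obtain ⟨s, hs, rfl⟩ := hs
  refine ⟨s, hs, ?_⟩
  rw [← map_mul, ← map_sub] at hu'
  have hker : ∀ x, Q x = 0 → x ∈ maximalIdeal O • (⊤ : Submodule O (Matrix ι ι ℍ[O,α,1,β])) := by
    intro x hx
    refine Matrix.mem_smul_top_of_forall x fun i j ↦ ?_
    have h1 : q (x i j) = 0 := congrFun (congrFun hx i) j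
    simp only [← residue_eq_zero_iff]
    exact ⟨congrArg QuaternionAlgebra.re h1, congrArg QuaternionAlgebra.imI h1,
      congrArg QuaternionAlgebra.imJ h1, congrArg QuaternionAlgebra.imK h1⟩
  obtain ⟨y', hy1, hy2⟩ := isUnit_iff_exists.1 hu'
  obtain ⟨y, rfl⟩ := hQs y'
  exact isUnit_of_exists_sub_mem_smul_top (O := O) _
    ⟨y, hker _ (by rw [map_sub, map_mul, hy1, map_one, sub_self])⟩
    ⟨y, hker _ (by rw [map_sub, map_mul, hy2, map_one, sub_self])⟩

end LocalRing

/-! ### Integral solutions at the places and their assembly over the adèles -/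

/-- All coordinates of all entries of the quaternion matrix `M` lie in `O`. -/
def Matrix.HasCoordsIn {K ι : Type*} [Field K] {α β : K} (M : Matrix ι ι ℍ[K,α,1,β])
    (O : ValuationSubring K) : Prop :=
  ∀ i j, (M i j).re ∈ O ∧ (M i j).imI ∈ O ∧ (M i j).imJ ∈ O ∧ (M i j).imK ∈ O

/-- This is the local ring case applied to $O$ and read inside $K$. What it adds to the field case
is integrality of both $s$ and the inverse $t$, as the restricted product requires. -/
theorem exists_isUnit_sub_mul_of_hasCoordsIn {K ι : Type*} [Field K] [Fintype ι] [DecidableEq ι]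
    (h2 : (2 : K) = 0) {α β : K} (O : ValuationSubring K) (hα : α ∈ O) (hβ : β ∈ O) (hβ0 : β ≠ 0)
    (hβi : β⁻¹ ∈ O) {a c u w : Matrix ι ι ℍ[K,α,1,β]} (ha : a.HasCoordsIn O) (hc : c.HasCoordsIn O)
    (hu : u.HasCoordsIn O) (hw : w.HasCoordsIn O) (huw : u * a + w * c = 1)
    (hsa : IsSelfAdjoint (star a * c)) :
    ∃ s t : Matrix ι ι ℍ[K,α,1,β], s.HasCoordsIn O ∧ t.HasCoordsIn O ∧ IsSelfAdjoint s ∧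
      (a - s * c) * t = 1 ∧ t * (a - s * c) = 1 := by
  let q : ℍ[O,⟨α, hα⟩,1,⟨β, hβ⟩] →+* ℍ[K,α,1,β] :=
    QuaternionAlgebra.mapRingHom (algebraMap O K) rfl rfl
  let Q := q.mapMatrix (m := ι)
  have hQs : ∀ x, Q (star x) = star (Q x) :=
    Matrix.mapMatrix_star q (QuaternionAlgebra.mapRingHom_star _ _ _)
  have hQm : ∀ x, (Q x).HasCoordsIn O := fun x i j ↦
    ⟨(x i j).re.2, (x i j).imI.2, (x i j).imJ.2, (x i j).imK.2⟩
  have hQe : ∀ M : Matrix ι ι ℍ[K,α,1,β], M.HasCoordsIn O → ∃ x, Q x = M := fun M hM ↦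
    ⟨Matrix.of fun i j ↦ ⟨⟨_, (hM i j).1⟩, ⟨_, (hM i j).2.1⟩, ⟨_, (hM i j).2.2.1⟩,
      ⟨_, (hM i j).2.2.2⟩⟩, rfl⟩
  have hQi : Function.Injective Q := by
    intro x y hxy
    refine Matrix.ext fun i j ↦ ?_
    have h1 : q (x i j) = q (y i j) := congrFun (congrFun hxy i) j
    exact QuaternionAlgebra.ext (Subtype.ext (congrArg QuaternionAlgebra.re h1))
      (Subtype.ext (congrArg QuaternionAlgebra.imI h1))
      (Subtype.ext (congrArg QuaternionAlgebra.imJ h1))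
      (Subtype.ext (congrArg QuaternionAlgebra.imK h1))
  obtain ⟨a, rfl⟩ := hQe a ha
  obtain ⟨c, rfl⟩ := hQe c hc
  obtain ⟨u, rfl⟩ := hQe u hu
  obtain ⟨w, rfl⟩ := hQe w hw
  have hβu : IsUnit (⟨β, hβ⟩ : O) := isUnit_iff_exists.2 ⟨⟨β⁻¹, hβi⟩,
    Subtype.ext (mul_inv_cancel₀ hβ0), Subtype.ext (inv_mul_cancel₀ hβ0)⟩
  obtain ⟨s, hs, hu⟩ := isStarUnitReducible_matrix_quaternionAlgebra_local (Subtype.ext h2) hβu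
    a c ((isStarCoprimePair_iff _ _).2 ⟨⟨u, w, hQi (by simpa using huw)⟩, hQi (by simpa [hQs] using hsa.star_eq)⟩)
  obtain ⟨t, ht1, ht2⟩ := isUnit_iff_exists.1 hu
  refine ⟨Q s, Q t, hQm s, hQm t, ?_, ?_, ?_⟩
  · rw [isSelfAdjoint_iff, ← hQs, hs.star_eq]
  · rw [← map_mul, ← map_sub, ← map_mul, ht1, map_one]
  · rw [← map_mul, ← map_sub, ← map_mul, ht2, map_one]

namespace GlobalField

variable {F : Type*} [Field F]

/-- The component of an adele at a non-Archimedean place. -/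
noncomputable def AdeleRing.proj (v : FinitePlace F) : AdeleRing F →+* v.Completion where
  toFun x := x.2.1 v
  map_one' := rfl
  map_mul' _ _ := rfl
  map_zero' := rfl
  map_add' _ _ := rfl

theorem AdeleRing.eventually_proj_mem (x : AdeleRing F) :
    ∀ᶠ v in Filter.cofinite, AdeleRing.proj v x ∈ v.integers :=
  x.2.2

theorem AdeleRing.proj_algebraMap [IsGlobalField F] (v : FinitePlace F) (x : F) :
    AdeleRing.proj v (algebraMap F (AdeleRing F) x) = algebraMap F v.Completion x :=
  rfl

/-- The adele with given non-Archimedean components and zero Archimedean components. -/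
noncomputable def AdeleRing.ofFinite (x : ∀ v : FinitePlace F, v.Completion)
    (hx : ∀ᶠ v in Filter.cofinite, x v ∈ v.integers) : AdeleRing F :=
  (0, ⟨x, hx⟩)

/-- An Archimedean place would embed $F$ in $\mathbb{C}$, where $2\neq0$; hence only the finite
components remain. -/
theorem AdeleRing.ext_proj (h2 : (2 : F) = 0) {x y : AdeleRing F}
    (h : ∀ v, AdeleRing.proj v x = AdeleRing.proj v y) : x = y := by
  have : IsEmpty (NumberField.InfinitePlace F) := ⟨fun v ↦ by
    have h1 := congrArg v.embedding h2
    rw [map_ofNat, map_zero] at h1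
    exact two_ne_zero h1⟩
  refine Prod.ext (funext fun v ↦ isEmptyElim v) (Subtype.ext (funext h))

/-- Solutions are chosen place by place: integral ones wherever the data are integral, arbitrary
ones at the finitely many other places. -/
theorem isStarUnitReducible_matrix_adele [IsGlobalField F] (h2 : (2 : F) = 0) (α β : F)
    (hβ : β ≠ 0) (ι : Type*) [Fintype ι] [DecidableEq ι] :
    IsStarUnitReducible (Matrix ι ι
      ℍ[AdeleRing F,algebraMap F (AdeleRing F) α,1,algebraMap F (AdeleRing F) β]) := by
  intro a c hac
  rw [isStarCoprimePair_iff] at hac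
  obtain ⟨⟨u, w, huw⟩, hsa⟩ := hac
  let q (v : FinitePlace F) :
      ℍ[AdeleRing F,algebraMap F (AdeleRing F) α,1,algebraMap F (AdeleRing F) β] →+*
      ℍ[v.Completion,algebraMap F v.Completion α,1,algebraMap F v.Completion β] :=
    QuaternionAlgebra.mapRingHom (AdeleRing.proj v) (AdeleRing.proj_algebraMap v α)
      (AdeleRing.proj_algebraMap v β)
  let Q (v : FinitePlace F) := (q v).mapMatrix (m := ι)
  have hQs : ∀ v x, Q v (star x) = star (Q v x) := fun v ↦
    Matrix.mapMatrix_star (q v) (QuaternionAlgebra.mapRingHom_star _ _ _)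
  have hQi : ∀ x y, (∀ v, Q v x = Q v y) → x = y := by
    intro x y hxy
    refine Matrix.ext fun i j ↦ ?_
    have h1 : ∀ v, q v (x i j) = q v (y i j) := fun v ↦ congrFun (congrFun (hxy v) i) j
    exact QuaternionAlgebra.ext
      (AdeleRing.ext_proj h2 fun v ↦ congrArg QuaternionAlgebra.re (h1 v))
      (AdeleRing.ext_proj h2 fun v ↦ congrArg QuaternionAlgebra.imI (h1 v))
      (AdeleRing.ext_proj h2 fun v ↦ congrArg QuaternionAlgebra.imJ (h1 v))
      (AdeleRing.ext_proj h2 fun v ↦ congrArg QuaternionAlgebra.imK (h1 v))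
  have hQm : ∀ x, ∀ᶠ v in Filter.cofinite, (Q v x).HasCoordsIn v.integers := by
    intro x
    unfold Matrix.HasCoordsIn
    simp only [Filter.eventually_all, Filter.eventually_and]
    exact fun i j ↦ ⟨AdeleRing.eventually_proj_mem _, AdeleRing.eventually_proj_mem _,
      AdeleRing.eventually_proj_mem _, AdeleRing.eventually_proj_mem _⟩
  have hQe : ∀ M : ∀ v : FinitePlace F, Matrix ι ι
      ℍ[v.Completion,algebraMap F v.Completion α,1,algebraMap F v.Completion β],
      (∀ᶠ v in Filter.cofinite, (M v).HasCoordsIn v.integers) → ∃ x, ∀ v, Q v x = M v := fun M hM ↦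
    ⟨Matrix.of fun i j ↦ ⟨AdeleRing.ofFinite (fun v ↦ (M v i j).re) (hM.mono fun v h ↦ (h i j).1),
      AdeleRing.ofFinite (fun v ↦ (M v i j).imI) (hM.mono fun v h ↦ (h i j).2.1),
      AdeleRing.ofFinite (fun v ↦ (M v i j).imJ) (hM.mono fun v h ↦ (h i j).2.2.1),
      AdeleRing.ofFinite (fun v ↦ (M v i j).imK) (hM.mono fun v h ↦ (h i j).2.2.2)⟩, fun v ↦ rfl⟩
  have huw' : ∀ v, Q v u * Q v a + Q v w * Q v c = 1 := fun v ↦ by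
    rw [← map_mul, ← map_mul, ← map_add, huw, map_one]
  have hsa' : ∀ v, IsSelfAdjoint (star (Q v a) * Q v c) := fun v ↦ by
    rw [← hQs, ← map_mul, isSelfAdjoint_iff, ← hQs, hsa.star_eq]
  have hβv : ∀ v : FinitePlace F, algebraMap F v.Completion β ≠ 0 := fun v ↦ by
    rwa [Ne, map_eq_zero]
  have h2v : ∀ v : FinitePlace F, (2 : v.Completion) = 0 := fun v ↦ by
    rw [← map_ofNat (algebraMap F v.Completion), h2, map_zero]
  -- The Bézout coefficients must be integral as well, so that the pair is admissible over $O_v$;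
  -- integrality of $\beta$ and $\beta^{-1}$ makes $\beta$ a unit of $O_v$.
  let good (v : FinitePlace F) : Prop :=
    (Q v a).HasCoordsIn v.integers ∧ (Q v c).HasCoordsIn v.integers ∧
    (Q v u).HasCoordsIn v.integers ∧ (Q v w).HasCoordsIn v.integers ∧
    algebraMap F v.Completion α ∈ v.integers ∧ algebraMap F v.Completion β ∈ v.integers ∧
    (algebraMap F v.Completion β)⁻¹ ∈ v.integers
  have hgood : ∀ᶠ v in Filter.cofinite, good v := by
    refine (hQm a).and <| (hQm c).and <| (hQm u).and <| (hQm w).and <| .and ?_ <| .and ?_ ?_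
    · exact AdeleRing.eventually_proj_mem (algebraMap F (AdeleRing F) α)
    · exact AdeleRing.eventually_proj_mem (algebraMap F (AdeleRing F) β)
    · refine (AdeleRing.eventually_proj_mem (algebraMap F (AdeleRing F) β⁻¹)).mono fun v hv ↦ ?_
      rwa [AdeleRing.proj_algebraMap, map_inv₀] at hv
  have hloc : ∀ v, ∃ s t : Matrix ι ι
      ℍ[v.Completion,algebraMap F v.Completion α,1,algebraMap F v.Completion β],
      (good v → s.HasCoordsIn v.integers ∧ t.HasCoordsIn v.integers) ∧ IsSelfAdjoint s ∧
      (Q v a - s * Q v c) * t = 1 ∧ t * (Q v a - s * Q v c) = 1 := by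
    intro v
    by_cases hv : good v
    · obtain ⟨ha, hc, hu, hw, hα, hβ1, hβ2⟩ := hv
      obtain ⟨s, t, hs, ht, h⟩ := exists_isUnit_sub_mul_of_hasCoordsIn (h2v v) v.integers hα hβ1
        (hβv v) hβ2 ha hc hu hw (huw' v) (hsa' v)
      exact ⟨s, t, fun _ ↦ ⟨hs, ht⟩, h⟩
    · obtain ⟨s, hs, hu⟩ := isStarUnitReducible_matrix_quaternionAlgebra_field (h2v v)
        (α := algebraMap F v.Completion α) (hβv v) ι (Q v a) (Q v c)
        ((isStarCoprimePair_iff _ _).2 ⟨⟨_, _, huw' v⟩, hsa' v⟩)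
      obtain ⟨t, ht1, ht2⟩ := isUnit_iff_exists.1 hu
      exact ⟨s, t, fun h ↦ absurd h hv, hs, ht1, ht2⟩
  choose s t hst hs h1 h3 using hloc
  obtain ⟨S, hS⟩ := hQe s (hgood.mono fun v hv ↦ (hst v hv).1)
  obtain ⟨T, hT⟩ := hQe t (hgood.mono fun v hv ↦ (hst v hv).2)
  refine ⟨S, hQi _ _ fun v ↦ ?_, isUnit_iff_exists.2 ⟨T, hQi _ _ fun v ↦ ?_, hQi _ _ fun v ↦ ?_⟩⟩
  · rw [hQs, hS, (hs v).star_eq]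
  · rw [map_mul, map_sub, map_mul, hS, hT, h1, map_one]
  · rw [map_mul, map_sub, map_mul, hS, hT, h3, map_one]

end GlobalField

/-! ### Discrete valuations at which a given element is close to a square -/

/-- The value group is a nontrivial subgroup of $\mathbb{Z}$, hence infinite cyclic. -/
theorem Valuation.isDiscreteValuationRing_of_lt_one {F : Type*} [Field F]
    (w : Valuation F (WithZero (Multiplicative ℤ))) {x : F} (hx0 : x ≠ 0) (hx : w x < 1) :
    IsDiscreteValuationRing w.valuationSubring := by
  have h0 : w x ≠ 0 := (Valuation.ne_zero_iff w).2 hx0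
  have : Nontrivial (MonoidWithZeroHom.valueGroup (MonoidWithZeroHom.ofClass w)) := by
    rw [Subgroup.nontrivial_iff_exists_ne_one]
    refine ⟨Units.mk0 (w x) h0, MonoidWithZeroHom.mem_valueGroup _ ⟨x, rfl⟩, fun h ↦ ?_⟩
    have := congrArg Units.val h
    simp only [Units.val_mk0, Units.val_one] at this
    exact hx.ne this
  have : IsCyclic (WithZero (Multiplicative ℤ))ˣ :=
    isCyclic_of_surjective (WithZero.unitsWithZeroEquiv (α := Multiplicative ℤ)).symm
      (WithZero.unitsWithZeroEquiv (α := Multiplicative ℤ)).symm.surjective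
  infer_instance

/-- The integral closure of $R$ in $E$ is a Dedekind domain in which $x$ is a nonzero nonunit, so a
nonzero maximal ideal contains it; its valuation is the one sought. -/
theorem exists_valuation_of_isSeparable (R K : Type*) {E : Type*} [CommRing R]
    [IsDedekindDomain R] [Field K] [Algebra R K] [IsFractionRing R K] [Field E] [Algebra R E]
    [Algebra K E] [IsScalarTower R K E] [FiniteDimensional K E] [Algebra.IsSeparable K E] {x : E}
    (hx : IsIntegral R x) (hx0 : x ≠ 0) (hxi : ¬ IsIntegral R x⁻¹) :
    ∃ w : Valuation E (WithZero (Multiplicative ℤ)), (∀ r : R, w (algebraMap R E r) ≤ 1) ∧ w x < 1 := by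
  have : IsDedekindDomain (integralClosure R E) :=
    IsIntegralClosure.isDedekindDomain R K E (integralClosure R E)
  have : IsFractionRing (integralClosure R E) E :=
    integralClosure.isFractionRing_of_finite_extension K E
  let y : integralClosure R E := ⟨x, hx⟩
  have hy : ¬ IsUnit y := by
    intro h
    obtain ⟨z, hz⟩ := h.exists_right_inv
    apply hxi
    rw [inv_eq_of_mul_eq_one_right (congrArg Subtype.val hz : x * (z : E) = 1)]
    exact z.2
  obtain ⟨I, hI, hyI⟩ := exists_max_ideal_of_mem_nonunits hy
  let p : HeightOneSpectrum (integralClosure R E) :=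
    { asIdeal := I
      isPrime := hI.isPrime
      ne_bot := by
        rintro rfl
        exact hx0 (congrArg Subtype.val (Ideal.mem_bot.1 hyI)) }
  refine ⟨p.valuation E, fun r ↦ ?_, ?_⟩
  · exact p.valuation_le_one (K := E) (algebraMap R (integralClosure R E) r)
  · exact (p.valuation_lt_one_iff_mem (K := E) y).2 hyI

/-- A nonzero integral element of a finite extension of `K = Frac R` which is not a unit of the
integral closure has a discrete valuation at which it is not a unit. -/
theorem exists_valuation_of_finiteDimensional (R K : Type*) {F : Type*} [CommRing R]
    [IsDedekindDomain R] [Field K] [Algebra R K] [IsFractionRing R K] [Field F] [Algebra R F]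
    [Algebra K F] [IsScalarTower R K F] [FiniteDimensional K F] {x : F}
    (hx : IsIntegral R x) (hx0 : x ≠ 0) (hxi : ¬ IsIntegral R x⁻¹) :
    ∃ w : Valuation F (WithZero (Multiplicative ℤ)), (∀ r : R, w (algebraMap R F r) ≤ 1) ∧ w x < 1 := by
  let E := separableClosure K F
  obtain ⟨q, hq⟩ := ExpChar.exists E
  have : IsScalarTower R E F := IsScalarTower.of_algebraMap_eq fun r ↦ by
    rw [IsScalarTower.algebraMap_apply R K E, ← IsScalarTower.algebraMap_apply K E F,
      ← IsScalarTower.algebraMap_apply R K F]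
  let n := IsPurelyInseparable.exponent E F
  -- A power of Frobenius maps $F$ into its separable part and preserves and reflects integrality,
  -- so the valuation found there pulls back to $F$.
  let φ : F →+* E := IsPurelyInseparable.iterateFrobenius E F q le_rfl
  have hφ : ∀ a, algebraMap E F (φ a) = a ^ q ^ n :=
    IsPurelyInseparable.algebraMap_iterateFrobenius E q le_rfl
  have hqn : 0 < q ^ n := pow_pos (expChar_pos E q) n
  have hint : ∀ a : F, IsIntegral R (φ a) ↔ IsIntegral R a := by
    intro a
    rw [← isIntegral_algebraMap_iff (algebraMap E F).injective, hφ]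
    exact ⟨fun h ↦ h.of_pow hqn, fun h ↦ h.pow _⟩
  obtain ⟨w, hw, hwx⟩ := exists_valuation_of_isSeparable R K ((hint x).2 hx)
    ((map_ne_zero φ).2 hx0) (by rwa [← map_inv₀, hint])
  refine ⟨w.comap φ, fun r ↦ ?_, hwx⟩
  have : φ (algebraMap R F r) = algebraMap R E (r ^ q ^ n) := by
    apply (algebraMap E F).injective
    rw [hφ, ← IsScalarTower.algebraMap_apply R E F, map_pow]
  rw [Valuation.comap_apply, this]
  exact hw _

open Polynomial in
/-- The values `x Y² - 1`, for `Y` in an infinite ring `R` with finitely many units, are not all units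
of the integral closure. -/
theorem exists_not_isIntegral_inv (R K : Type*) {F : Type*} [CommRing R] [IsDomain R]
    [IsIntegrallyClosed R] [Infinite R] [Finite Rˣ] [Field K] [Algebra R K] [IsFractionRing R K]
    [Field F] [Algebra R F] [Algebra K F] [IsScalarTower R K F] [FiniteDimensional K F] {x : F}
    (hx : IsIntegral R x) (hx0 : x ≠ 0) :
    ∃ Y : R, x * algebraMap R F Y ^ 2 - 1 ≠ 0 ∧ ¬ IsIntegral R (x * algebraMap R F Y ^ 2 - 1)⁻¹ := by
  by_contra! h
  let N : R → K := fun Y ↦ Algebra.norm K (x * algebraMap R F Y ^ 2 - 1)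
  let g := (Algebra.lmul K F x).charpoly
  -- Were the claim false, every norm of $xY^2-1$ would lie in this finite set: it is zero or a unit
  -- of $R$.
  let S : Set K := insert 0 (Set.range fun u : Rˣ ↦ algebraMap R K u)
  have hS : S.Finite := (Set.finite_range _).insert 0
  have hNS : ∀ Y, N Y ∈ S := by
    intro Y
    by_cases h0 : x * algebraMap R F Y ^ 2 - 1 = 0
    · left
      simp only [N, h0, Algebra.norm_zero]
    · right
      have h1 : IsIntegral R (x * algebraMap R F Y ^ 2 - 1) :=
        (hx.mul (isIntegral_algebraMap.pow 2)).sub isIntegral_one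
      obtain ⟨r, hr⟩ := IsIntegrallyClosed.isIntegral_iff.1 (Algebra.isIntegral_norm K h1)
      obtain ⟨s, hs⟩ := IsIntegrallyClosed.isIntegral_iff.1 (Algebra.isIntegral_norm K (h Y h0))
      have hrs : r * s = 1 := by
        apply IsFractionRing.injective R K
        rw [map_mul, hr, hs, ← map_mul, mul_inv_cancel₀ h0, map_one, map_one]
      exact ⟨⟨r, s, hrs, by rw [mul_comm, hrs]⟩, hr⟩
  obtain ⟨d, hd⟩ : ∃ d, d = Module.finrank K F := ⟨_, rfl⟩
  have hgd : g.natDegree = d := by rw [hd]; exact LinearMap.charpoly_natDegree _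
  have hg0 : g.coeff 0 ≠ 0 := by
    rw [coeff_zero_eq_eval_zero, LinearMap.eval_charpoly, map_zero, zero_sub, ← map_neg,
      ← Algebra.norm_apply]
    rw [Algebra.norm_ne_zero_iff]
    exact neg_ne_zero.2 hx0
  have hd0 : 0 < d := hd ▸ Module.finrank_pos
  -- For $Y\neq0$ the norm of $xY^2-1=-Y^2(Y^{-2}-x)$ is $(-Y^2)^d g(Y^{-2})$, with $g$ the
  -- characteristic polynomial of multiplication by $x$; this is a polynomial in $Y$.
  let k : K[X] := C ((-1) ^ d) * g.reverse.comp (X ^ 2)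
  have hk : ∀ Y : R, Y ≠ 0 → k.eval (algebraMap R K Y) = N Y := by
    intro Y hY
    have hY' : algebraMap R K Y ≠ 0 := by
      rwa [Ne, map_eq_zero_iff _ (IsFractionRing.injective R K)]
    have hYF : algebraMap R F Y ≠ 0 := by
      rw [IsScalarTower.algebraMap_apply R K F]; exact (_root_.map_ne_zero _).2 hY'
    have h1 : Invertible ((algebraMap R K Y ^ 2)⁻¹) := invertibleOfNonzero (by positivity)
    have h2 := eval₂_reverse_mul_pow (RingHom.id K) ((algebraMap R K Y ^ 2)⁻¹) g
    rw [invOf_eq_inv, inv_inv, ← eval, ← eval, LinearMap.eval_charpoly, hgd] at h2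
    have h3 : algebraMap K (Module.End K F) ((algebraMap R K Y ^ 2)⁻¹) - Algebra.lmul K F x =
        Algebra.lmul K F (algebraMap K F ((algebraMap R K Y ^ 2)⁻¹) - x) := by
      rw [map_sub]
      congr 1
      ext z
      simp [Algebra.smul_def]
    rw [h3, ← Algebra.norm_apply] at h2
    have h4 : x * algebraMap R F Y ^ 2 - 1 = algebraMap K F (- algebraMap R K Y ^ 2) *
        (algebraMap K F ((algebraMap R K Y ^ 2)⁻¹) - x) := by
      rw [map_neg, map_inv₀, map_pow, ← IsScalarTower.algebraMap_apply R K F]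
      field_simp
      ring
    simp only [N, k]
    rw [h4, map_mul, ← h2, Algebra.norm_algebraMap, ← hd, eval_mul, eval_C, eval_comp, eval_pow,
      eval_X]
    have h5 : (-algebraMap R K Y ^ 2) ^ d * ((algebraMap R K Y ^ 2)⁻¹) ^ d = (-1) ^ d := by
      rw [← mul_pow, neg_mul, mul_inv_cancel₀ (pow_ne_zero 2 hY')]
    linear_combination -eval (algebraMap R K Y ^ 2) g.reverse * h5
  -- By pigeonhole one norm value is taken infinitely often, so the polynomial is constant; but it
  -- has degree $2d>0$, because $g(0)=\pm N(x)\neq0$ keeps the degree of the reversal equal to $d$.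
  obtain ⟨s, -, hs⟩ : ∃ s ∈ S, {Y : R | Y ≠ 0 ∧ N Y = s}.Infinite := by
    by_contra! hc
    have hfin : {Y : R | Y ≠ 0}.Finite := by
      refine (hS.biUnion (t := fun s ↦ {Y : R | Y ≠ 0 ∧ N Y = s}) hc).subset fun Y hY ↦ ?_
      simp only [Set.mem_iUnion]
      exact ⟨N Y, hNS Y, hY, rfl⟩
    exact Set.infinite_univ ((hfin.insert 0).subset fun Y _ ↦ by
      by_cases hY : Y = 0
      · exact Or.inl hY
      · exact Or.inr hY)
  have hks : k = C s := by
    refine Polynomial.eq_of_infinite_eval_eq _ _ ?_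
    refine (hs.image (IsFractionRing.injective R K).injOn).mono ?_
    rintro _ ⟨Y, ⟨hY, rfl⟩, rfl⟩
    rw [Set.mem_ofPred_eq, hk Y hY, eval_C]
  have hdeg : k.natDegree = d * 2 := by
    simp only [k]
    rw [natDegree_C_mul (by simp), natDegree_comp, natDegree_X_pow, reverse_natDegree,
      hgd, natTrailingDegree_eq_zero.2 (Or.inr hg0), Nat.sub_zero]
  rw [hks, natDegree_C] at hdeg
  omega

/-- For `δ ≠ 0` and a nonzero natural number `c` there is a discrete valuation at which `c` is a unit
and `δ` is congruent to a square up to squares. -/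
theorem exists_valuation_mul_sq_sub_one_lt_one (R K : Type*) {F : Type*} [CommRing R]
    [IsDedekindDomain R] [Infinite R] [Finite Rˣ] [Field K] [Algebra R K]
    [IsFractionRing R K] [Field F] [Algebra R F] [Algebra K F] [IsScalarTower R K F]
    [FiniteDimensional K F] {δ : F} (hδ : δ ≠ 0) (c : ℕ) (hc : (c : F) ≠ 0) :
    ∃ (w : Valuation F (WithZero (Multiplicative ℤ))) (z : F), δ * z ^ 2 - 1 ≠ 0 ∧
      w (δ * z ^ 2 - 1) < 1 ∧ w c = 1 := by
  have halg : Algebra.IsAlgebraic R F := by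
    rw [IsFractionRing.comap_isAlgebraic_iff (A := R) (K := K) (C := F)]
    infer_instance
  obtain ⟨d, hd0, hd⟩ := (halg.isAlgebraic δ).exists_integral_multiple
  have hd0' : algebraMap R F d ≠ 0 := by
    rw [IsScalarTower.algebraMap_apply R K F]
    refine (map_ne_zero _).2 ?_
    rwa [Ne, map_eq_zero_iff _ (IsFractionRing.injective R K)]
  -- Multiplying by $d$ a second time gives $d^2\delta$, which is integral and differs from $\delta$
  -- by a square.
  have hx : IsIntegral R (algebraMap R F d * (d • δ)) := isIntegral_algebraMap.mul hd
  have hcc : (c : F) = algebraMap R F c := (map_natCast _ c).symm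
  -- The factor $c^2$ forces $w(c)=1$: were $w(c)<1$, both $xY^2$ and $xY^2-1$ would have value
  -- below 1, and hence so would 1.
  have hx' : IsIntegral R ((c : F) ^ 2 * (algebraMap R F d * (d • δ))) := by
    rw [hcc]; exact (isIntegral_algebraMap.pow 2).mul hx
  obtain ⟨Y, hY0, hY⟩ := exists_not_isIntegral_inv R K hx' (by
    rw [Algebra.smul_def]
    exact mul_ne_zero (pow_ne_zero 2 hc) (mul_ne_zero hd0' (mul_ne_zero hd0' hδ)))
  obtain ⟨w, hw, hwx⟩ := exists_valuation_of_finiteDimensional R K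
    ((hx'.mul (isIntegral_algebraMap.pow 2)).sub isIntegral_one) hY0 hY
  have he : (c : F) ^ 2 * (algebraMap R F d * (d • δ)) * algebraMap R F Y ^ 2 - 1 =
      δ * (c * algebraMap R F d * algebraMap R F Y) ^ 2 - 1 := by
    rw [Algebra.smul_def]; ring
  have hwint : ∀ a : F, IsIntegral R a → w a ≤ 1 := fun a ha ↦
    w.valuationSubring.mem_of_isIntegral_of_le hw a ha
  refine ⟨w, c * algebraMap R F d * algebraMap R F Y, he ▸ hY0, he ▸ hwx, ?_⟩
  refine le_antisymm (hcc ▸ hw c) ?_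
  by_contra! hlt
  have h1 : w ((c : F) ^ 2 * (algebraMap R F d * (d • δ)) * algebraMap R F Y ^ 2) < 1 := by
    have e : (c : F) ^ 2 * (algebraMap R F d * (d • δ)) * algebraMap R F Y ^ 2 =
        c * (c * ((algebraMap R F d * (d • δ)) * algebraMap R F Y ^ 2)) := by ring
    rw [e, map_mul]
    refine mul_lt_one_of_lt_of_le hlt (hwint _ ?_)
    rw [hcc]
    exact isIntegral_algebraMap.mul (hx.mul (isIntegral_algebraMap.pow 2))
  have h2 := w.map_sub_lt h1 hwx
  rw [sub_sub_cancel, map_one] at h2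
  exact lt_irrefl _ h2

theorem IsGlobalField.exists_valuation {F : Type*} [Field F] [IsGlobalField F] {δ : F} (hδ : δ ≠ 0)
    (c : ℕ) (hc : (c : F) ≠ 0) :
    ∃ (w : Valuation F (WithZero (Multiplicative ℤ))) (z : F), δ * z ^ 2 - 1 ≠ 0 ∧
      w (δ * z ^ 2 - 1) < 1 ∧ w c = 1 := by
  rcases IsGlobalField.numberField_or_functionField (F := F) with h | ⟨k, _, _, _, h⟩
  · exact exists_valuation_mul_sq_sub_one_lt_one ℤ ℚ hδ c hc
  · let _ : Algebra (Polynomial k) F :=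
      ((algebraMap (RatFunc k) F).comp (algebraMap (Polynomial k) (RatFunc k))).toAlgebra
    have : IsScalarTower (Polynomial k) (RatFunc k) F := IsScalarTower.of_algebraMap_eq fun _ ↦ rfl
    have : FiniteDimensional (RatFunc k) F := h
    have : Finite (Polynomial k)ˣ := by
      refine Finite.of_injective (fun u ↦ (u : Polynomial k).coeff 0) fun u v huv ↦ ?_
      obtain ⟨a, -, ha⟩ := Polynomial.isUnit_iff.1 u.isUnit
      obtain ⟨b, -, hb⟩ := Polynomial.isUnit_iff.1 v.isUnit
      apply Units.ext
      simp only [← ha, ← hb, Polynomial.coeff_C_zero] at huv ⊢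
      rw [huv]
    exact exists_valuation_mul_sq_sub_one_lt_one (Polynomial k) (RatFunc k) hδ c hc

/-! ### Square roots in completions -/

open Filter Topology in
theorem Valued.tendsto_zero_of_le_pow {K Γ : Type*} [Field K] [LinearOrderedCommGroupWithZero Γ]
    [MulArchimedean Γ] [Valued K Γ] {f : ℕ → K} {r : Γ} (hr : r < 1)
    (hf : ∀ n, Valued.v (f n) ≤ r ^ (n + 1)) : Tendsto f atTop (𝓝 0) := by
  rw [(Valued.hasBasis_nhds_zero K Γ).tendsto_right_iff]
  intro γ _
  obtain ⟨N, hN⟩ := exists_pow_lt₀ hr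
    (Units.mk0 _ (MonoidWithZeroHom.ValueGroup₀.embedding_unit_ne_zero γ))
  filter_upwards [eventually_ge_atTop N] with n hn
  rw [Valuation.restrict_lt_iff_lt_embedding]
  refine lt_of_le_of_lt (hf n) (lt_of_le_of_lt ?_ hN)
  exact pow_le_pow_right_of_le_one' hr.le (by omega)

open Filter Topology in
/-- Hensel's lemma for square roots. -/
theorem Valued.exists_mul_self_eq {K Γ : Type*} [Field K] [LinearOrderedCommGroupWithZero Γ]
    [MulArchimedean Γ] [Valued K Γ] [CompleteSpace K] [T2Space K]
    (h2 : Valued.v (2 : K) = (1 : Γ)) {d : K} (hd : Valued.v (d - 1) < (1 : Γ)) :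
    ∃ s : K, s * s = d := by
  set r : Γ := Valued.v (d - 1)
  have h20 : (2 : K) ≠ 0 := fun h ↦ by
    rw [h, map_zero] at h2
    exact zero_ne_one h2
  -- Newton iteration with the derivative $2x_n$ replaced by $2$, which is harmless as $x_n$ stays
  -- congruent to 1. The error $e=x_n^2-d$ becomes $(e/2)^2-e(x_n-1)$, so each step gains a factor
  -- $r=v(d-1)$.
  let x : ℕ → K := fun n ↦ Nat.rec 1 (fun _ y ↦ y - (y * y - d) / 2) n
  have hx0 : x 0 = 1 := rfl
  have hx : ∀ n, x (n + 1) = x n - (x n * x n - d) / 2 := fun n ↦ rfl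
  have hdiv : ∀ y : K, Valued.v (y / 2) = (Valued.v y : Γ) := fun y ↦ by
    rw [map_div₀, h2, div_one]
  have hinv : ∀ n, Valued.v (x n - 1) ≤ r ∧ Valued.v (x n * x n - d) ≤ r ^ (n + 1) := by
    intro n
    induction n with
    | zero =>
      rw [hx0, sub_self, map_zero, mul_one, Valuation.map_sub_swap, zero_add, pow_one]
      exact ⟨zero_le, le_rfl⟩
    | succ n ih =>
      have hle : r ^ (n + 1) ≤ r := by
        simpa using pow_le_pow_right_of_le_one' hd.le (Nat.succ_le_succ (Nat.zero_le n))
      constructor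
      · have e : x (n + 1) - 1 = (x n - 1) - (x n * x n - d) / 2 := by rw [hx]; ring
        rw [e]
        exact Valuation.map_sub_le _ ih.1 ((hdiv _).trans_le (ih.2.trans hle))
      · have e : x (n + 1) * x (n + 1) - d =
            (x n * x n - d) / 2 * ((x n * x n - d) / 2) - (x n * x n - d) * (x n - 1) := by
          rw [hx]; field_simp; ring
        rw [e]
        refine Valuation.map_sub_le _ ?_ ?_
        · rw [map_mul, hdiv, pow_succ]
          exact mul_le_mul' ih.2 (ih.2.trans hle)
        · rw [map_mul, pow_succ]
          exact mul_le_mul' ih.2 ih.1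
  -- Valuation balls are open subgroups, so a sequence whose consecutive differences tend to zero is
  -- Cauchy.
  have : NonarchimedeanAddGroup K :=
    { is_nonarchimedean := fun U hU ↦ by
        obtain ⟨γ, hγ⟩ := Valued.mem_nhds_zero.1 hU
        let G := ((Valued.v : Valuation K Γ).restrict).ltAddSubgroup γ
        have hG : (G : Set K) = {x | (Valued.v : Valuation K Γ).restrict x < γ} :=
          Valuation.coe_ltAddSubgroup _ _
        refine ⟨⟨G, AddSubgroup.isOpen_of_mem_nhds G (g := 0) ?_⟩, ?_⟩
        · rw [hG]; exact Valued.mem_nhds_zero.2 ⟨γ, subset_rfl⟩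
        · exact hG.trans_subset hγ }
  have hc : CauchySeq x := by
    refine NonarchimedeanAddGroup.cauchySeq_of_tendsto_sub_nhds_zero ?_
    refine Valued.tendsto_zero_of_le_pow hd fun n ↦ ?_
    have e : x (n + 1) - x n = -((x n * x n - d) / 2) := by rw [hx]; ring
    rw [e, Valuation.map_neg, hdiv]
    exact (hinv n).2
  obtain ⟨s, hs⟩ := cauchySeq_tendsto_of_complete hc
  refine ⟨s, ?_⟩
  have h1 : Tendsto (fun n ↦ x n * x n - d) atTop (𝓝 (s * s - d)) := (hs.mul hs).sub_const d
  exact sub_eq_zero.1 (tendsto_nhds_unique h1 (Valued.tendsto_zero_of_le_pow hd fun n ↦ (hinv n).2))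

/-! ### Places at which a given element becomes a square -/

namespace GlobalField

theorem FinitePlace.valued_algebraMap_lt_one {F : Type*} [Field F] (v : FinitePlace F) {x : F}
    (hx : x ≠ 0) (h : x⁻¹ ∉ v.1) : Valued.v (algebraMap F v.Completion x) < 1 := by
  rw [← FinitePlace.coe_mem_integers_iff, HeightOneSpectrum.mem_adicCompletionIntegers, map_inv₀,
    map_inv₀, not_le] at h
  have h0 : Valued.v (algebraMap F v.Completion x) ≠ 0 :=
    (Valuation.ne_zero_iff _).2 ((map_ne_zero _).2 hx)
  exact (one_lt_inv₀ (zero_lt_iff.2 h0)).1 h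

theorem FinitePlace.valued_algebraMap_eq_one {F : Type*} [Field F] (v : FinitePlace F) {x : F}
    (hx : x ≠ 0) (h : x ∈ v.1) (h' : x⁻¹ ∈ v.1) : Valued.v (algebraMap F v.Completion x) = 1 := by
  rw [← FinitePlace.coe_mem_integers_iff, HeightOneSpectrum.mem_adicCompletionIntegers] at h h'
  have h0 : Valued.v (algebraMap F v.Completion x) ≠ 0 :=
    (Valuation.ne_zero_iff _).2 ((map_ne_zero _).2 hx)
  rw [map_inv₀, map_inv₀, inv_le_one₀ (zero_lt_iff.2 h0)] at h'
  exact le_antisymm h h'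

theorem FinitePlace.nonempty (F : Type*) [Field F] [IsGlobalField F] : Nonempty (FinitePlace F) := by
  obtain ⟨w, z, h0, h1, -⟩ := IsGlobalField.exists_valuation (one_ne_zero (α := F)) 1 (by simp)
  exact ⟨⟨w.valuationSubring, w.isDiscreteValuationRing_of_lt_one h0 h1⟩⟩

instance (F : Type*) [Field F] [IsGlobalField F] : Nontrivial (AdeleRing F) :=
  (AdeleRing.proj (FinitePlace.nonempty F).some).domain_nontrivial

/-- A nonzero element of a global field of characteristic different from two is a square at some
place. -/
theorem FinitePlace.exists_mul_self_eq {F : Type*} [Field F] [IsGlobalField F] (h2 : (2 : F) ≠ 0)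
    {δ : F} (hδ : δ ≠ 0) :
    ∃ (v : FinitePlace F) (s : v.Completion), s * s = algebraMap F v.Completion δ := by
  obtain ⟨w, z, h0, h1, hw2⟩ := IsGlobalField.exists_valuation hδ 2 (by exact_mod_cast h2)
  let v : FinitePlace F := ⟨w.valuationSubring, w.isDiscreteValuationRing_of_lt_one h0 h1⟩
  have hmem : ∀ x, x ∈ v.1 ↔ w x ≤ 1 := fun x ↦ Iff.rfl
  have hz : z ≠ 0 := by
    rintro rfl
    simp at h1
  have hz' : algebraMap F v.Completion z ≠ 0 := (map_ne_zero _).2 hz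
  rw [Nat.cast_ofNat] at hw2
  -- At $v$ the element $\delta z^2$ is congruent to 1 and 2 is a unit, so Hensel's lemma applies;
  -- dividing the root by $z$ gives a root of $\delta$.
  obtain ⟨s, hs⟩ := Valued.exists_mul_self_eq (K := v.Completion)
    (d := algebraMap F v.Completion (δ * z ^ 2))
    (by
      have := v.valued_algebraMap_eq_one h2 (by rw [hmem, hw2])
        (by rw [hmem, map_inv₀, hw2, inv_one])
      rwa [map_ofNat] at this)
    (by
      have := v.valued_algebraMap_lt_one h0 (by
        rw [hmem, map_inv₀, not_le]
        exact (one_lt_inv₀ (zero_lt_iff.2 ((Valuation.ne_zero_iff _).2 h0))).2 h1)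
      rwa [map_sub, map_one] at this)
  refine ⟨v, s / algebraMap F v.Completion z, ?_⟩
  rw [div_mul_div_comm, hs, map_mul, map_pow]
  field_simp

end GlobalField

/-! ### The determinant obstruction -/

section Determinant

open Matrix

variable {A K N : Type*} [Ring A] [StarRing A] [Field K] [Fintype N] [DecidableEq N]

theorem Matrix.det_fromBlocks_zero_one_neg_one (s : Matrix N N K) :
    (fromBlocks (0 : Matrix N N K) 1 (-1) s).det = 1 := by
  have h : fromBlocks (0 : Matrix N N K) (1 : Matrix N N K) (-1 : Matrix N N K) s =
      fromBlocks 1 0 (s - 1) 1 * (fromBlocks 1 1 0 1 *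
        (fromBlocks 1 0 (-1) 1)) := by
    simp [fromBlocks_multiply]
  rw [h]
  simp [det_mul]

/-- The first column of a matrix `[a b; c d]` in the unitary group of the hyperbolic plane admits a
decomposition only if the determinant is `1`. -/
theorem HasStarEuclideanDecomposition.det_eq_one (φ : A →+* Matrix N N K)
    (hφ : ∀ x, (φ (star x)).det = (φ x).det) {m : ℕ} {a b c d : A}
    (h : HasStarEuclideanDecomposition a c m) (hac : star a * c = star c * a)
    (hbd : star b * d = star d * b) (h1 : star a * d - star c * b = 1) :
    (fromBlocks (φ a) (φ b) (φ c) (φ d)).det = 1 := by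
  induction m generalizing a b c d with
  | zero =>
    obtain ⟨s, r, -, hr1, -, hu⟩ := h
    rw [zero_add, hr1] at hu
    have hc : (φ c).det ≠ 0 := ((Matrix.isUnit_iff_isUnit_det _).1 (hu.map φ)).ne_zero
    -- Here $c$ itself is a unit. The unitary relations clear the second block row, giving
    -- $\det\varphi(c^*)\det g=\det\varphi(c)$, and the two outer determinants agree and are
    -- nonzero.
    have e : fromBlocks 1 0 0 (φ (star c)) * (fromBlocks 0 1 (-1) 0 *
        fromBlocks (φ a) (φ b) (φ c) (φ d)) =
        fromBlocks 1 0 (-φ (star a)) 1 * fromBlocks (φ c) (φ d) 0 1 := by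
      have e1 : -(star c * b) = -(star a * d) + 1 := by rw [← h1]; abel
      have e1' := congrArg φ e1
      have e2' := congrArg φ hac
      simp only [map_neg, map_add, map_mul, map_one] at e1' e2'
      simp [fromBlocks_multiply, e1', e2']
    have e' := congrArg det e
    rw [det_mul, det_mul, det_mul, det_fromBlocks_zero_one_neg_one, det_fromBlocks_zero₁₂,
      det_fromBlocks_zero₁₂, det_fromBlocks_zero₂₁, hφ] at e'
    simp only [det_one, one_mul, mul_one] at e'
    exact mul_left_cancel₀ hc (e'.trans (mul_one _).symm)
  | succ m ih =>
    obtain ⟨s, r, hr0, hr1, hr, hu⟩ := h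
    obtain ⟨hs, hr2⟩ := hr 0 (Nat.succ_pos m)
    rw [zero_add, zero_add, hr0, hr1] at hr2
    have hs' := hs.star_eq
    set t := s 0
    have hr2' : r 2 = a - t * c := by rw [hr2]; abel
    -- One division step multiplies $g$ on the left by the matrix with rows $(0,1)$, $(-1,t)$.
    -- Conjugation by $\mathrm{diag}(1,-1)$ makes the new first column $(c,\,a-tc)$ with the right
    -- sign and leaves the determinant alone.
    have key := ih (a := c) (b := -d) (c := a - t * c) (d := t * d - b)
      ⟨fun i ↦ s (i + 1), fun i ↦ r (i + 1), hr1, hr2', fun i hi ↦ hr (i + 1) (by omega), hu⟩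
      (by simp only [star_sub, star_mul, hs', mul_sub, sub_mul, hac, mul_assoc])
      (by
          simp only [star_sub, star_mul, star_neg, hs', mul_sub, sub_mul, hbd, mul_neg, neg_mul,
            mul_assoc]
          abel)
      (by
        rw [← h1]
        simp only [star_sub, star_mul, hs', mul_sub, sub_mul, mul_neg, mul_assoc]
        abel)
    have e : fromBlocks (φ c) (φ (-d)) (φ (a - t * c)) (φ (t * d - b)) =
        fromBlocks 1 0 0 (-1) * (fromBlocks 0 1 (-1) (φ t) *
        fromBlocks (φ a) (φ b) (φ c) (φ d)) * fromBlocks 1 0 0 (-1) := by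
      simp [fromBlocks_multiply, sub_eq_add_neg, add_comm]
    rw [e, det_mul, det_mul, det_mul, det_fromBlocks_zero_one_neg_one, one_mul, mul_right_comm,
      ← det_mul, fromBlocks_multiply] at key
    simpa using key

end Determinant

/-! ### Failure over a field that splits the quaternion algebra -/

namespace QuaternionAlgebra

open Matrix

variable {K : Type*} [Field K]

/-- The splitting of a quaternion algebra given by a root of `X² - X - α`. -/
def splitBasis {α β r : K} (hr : r * r = α + r) : Basis (Matrix (Fin 2) (Fin 2) K) α 1 β where
  i := !![r, 0; 0, 1 - r]
  j := !![0, β; 1, 0]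
  k := !![0, r * β; 1 - r, 0]
  i_mul_i := by
    ext i j; fin_cases i <;> fin_cases j <;> simp
    · exact hr
    · linear_combination hr
  j_mul_j := by
    ext i j; fin_cases i <;> fin_cases j <;> simp
  i_mul_j := by
    ext i j; fin_cases i <;> fin_cases j <;> simp
  j_mul_i := by
    ext i j; fin_cases i <;> fin_cases j <;> simp
    ring

theorem lift_splitBasis {α β r : K} (hr : r * r = α + r) (x : ℍ[K,α,1,β]) :
    QuaternionAlgebra.lift (splitBasis hr) x =
      !![x.re + x.imI * r, β * (x.imJ + x.imK * r);
        x.imJ + x.imK * (1 - r), x.re + x.imI * (1 - r)] := by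
  change algebraMap K _ x.re + x.imI • (splitBasis hr (β := β)).i +
    x.imJ • (splitBasis hr (β := β)).j + x.imK • (splitBasis hr (β := β)).k = _
  ext i j; fin_cases i <;> fin_cases j <;> simp [splitBasis, Matrix.algebraMap_matrix_apply]
  ring

theorem lift_splitBasis_star {α β r : K} (hr : r * r = α + r) (x : ℍ[K,α,1,β]) :
    QuaternionAlgebra.lift (splitBasis hr) (star x) =
      (QuaternionAlgebra.lift (splitBasis hr) x).adjugate := by
  rw [lift_splitBasis, lift_splitBasis, Matrix.adjugate_fin_two_of]
  ext i j; fin_cases i <;> fin_cases j <;> simp <;> ring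

/-- The matrix units $E_{11}$, $\beta^{-1}E_{21}$, $\beta E_{12}$, $E_{22}$, taken as $a,b,c,d$,
satisfy the unitary relations, and the resulting $4\times4$ matrix exchanges two coordinates up to
scaling, so its determinant is $-1$. Placed in one diagonal position and completed by the identity,
they give an admissible pair without decomposition. -/
theorem not_isStarEuclidean_matrix (h2 : (2 : K) ≠ 0) {α β r : K} (hr : r * r = α + r)
    (hα : 1 + 4 * α ≠ 0) (hβ : β ≠ 0) (ι : Type*) [Fintype ι] [DecidableEq ι] (o : ι) :
    ¬ IsStarEuclidean (Matrix ι ι ℍ[K,α,1,β]) := by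
  intro hE
  let φ₀ : ℍ[K,α,1,β] →+* Matrix (Fin 2) (Fin 2) K :=
    (QuaternionAlgebra.lift (splitBasis hr)).toRingHom
  have hφ₀ : ∀ x, φ₀ x = !![x.re + x.imI * r, β * (x.imJ + x.imK * r);
        x.imJ + x.imK * (1 - r), x.re + x.imI * (1 - r)] := lift_splitBasis hr
  have hφ₀s : ∀ x, φ₀ (star x) = (φ₀ x).adjugate := lift_splitBasis_star hr
  let φ : Matrix ι ι ℍ[K,α,1,β] →+* Matrix (ι × Fin 2) (ι × Fin 2) K :=
    (Matrix.compRingEquiv ι (Fin 2) K : _ →+* _).comp φ₀.mapMatrix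
  have hφ : ∀ x i j k l, φ x (i, k) (j, l) = φ₀ (x i j) k l := fun x i j k l ↦ rfl
  let J : Matrix (ι × Fin 2) (ι × Fin 2) K :=
    Matrix.of fun x y ↦ if x.1 = y.1 then (!![0, 1; -1, 0] : Matrix (Fin 2) (Fin 2) K) x.2 y.2 else 0
  have hJ : J * -J = 1 := by
    ext ⟨i, k⟩ ⟨j, l⟩
    simp only [mul_apply, Fintype.sum_prod_type, J, of_apply, one_apply, Prod.mk.injEq]
    by_cases hij : i = j <;> fin_cases k <;> fin_cases l <;>
      simp [hij, Fin.sum_univ_two]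
  have hdet : ∀ x, (φ (star x)).det = (φ x).det := by
    intro x
    have e : φ (star x) = J * (φ x)ᵀ * -J := by
      ext ⟨i, k⟩ ⟨j, l⟩
      have hs : φ₀ (star x i j) = (φ₀ (x j i)).adjugate := hφ₀s _
      rw [hφ, hs, adjugate_fin_two]
      simp only [mul_apply, Fintype.sum_prod_type, J, of_apply, transpose_apply, hφ]
      fin_cases k <;> fin_cases l <;> simp [Fin.sum_univ_two]
    have hJ' := congrArg det hJ
    rw [det_mul, det_one] at hJ'
    rw [e, det_mul, det_mul, det_transpose]
    linear_combination (φ x).det * hJ'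
  set D : K := 2 * r - 1
  have hD : D ≠ 0 := by
    intro h0
    apply hα
    have : D = 2 * r - 1 := rfl
    linear_combination D * h0 + (D + 2 * r - 1) * this - 4 * hr
  -- As $i\mapsto\mathrm{diag}(r,1-r)$ and $D=2r-1$ is the difference of the two roots, $p$ and
  -- $d_0=1-p$ are the diagonal idempotents; then $c_0=pj$ and $b_0=\beta^{-1}d_0j$.
  let p : ℍ[K,α,1,β] := ⟨(r - 1) / D, 1 / D, 0, 0⟩
  let c₀ : ℍ[K,α,1,β] := ⟨0, 0, (r - 1) / D, 1 / D⟩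
  let b₀ : ℍ[K,α,1,β] := ⟨0, 0, r / (D * β), -1 / (D * β)⟩
  let d₀ : ℍ[K,α,1,β] := ⟨r / D, -1 / D, 0, 0⟩
  let a : Matrix ι ι ℍ[K,α,1,β] := diagonal fun i ↦ if i = o then p else 1
  let b : Matrix ι ι ℍ[K,α,1,β] := diagonal fun i ↦ if i = o then b₀ else 0
  let c : Matrix ι ι ℍ[K,α,1,β] := diagonal fun i ↦ if i = o then c₀ else 0
  let d : Matrix ι ι ℍ[K,α,1,β] := diagonal fun i ↦ if i = o then d₀ else 1
  have hφinj : Function.Injective φ₀ := by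
    rw [injective_iff_map_eq_zero]
    intro x hx
    rw [hφ₀] at hx
    have e00 := congrFun (congrFun hx 0) 0
    have e01 := congrFun (congrFun hx 0) 1
    have e10 := congrFun (congrFun hx 1) 0
    have e11 := congrFun (congrFun hx 1) 1
    simp only [of_apply, cons_val_zero, cons_val_one, Matrix.zero_apply, mul_eq_zero, hβ, false_or,
      cons_val_fin_one] at e00 e01 e10 e11
    have hI : x.imI = 0 := (mul_eq_zero.1 (by linear_combination e00 - e11 :
      D * x.imI = 0)).resolve_left hD
    have hK : x.imK = 0 := (mul_eq_zero.1 (by linear_combination e01 - e10 :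
      D * x.imK = 0)).resolve_left hD
    ext
    · simpa [hI] using e00
    · exact hI
    · simpa [hK] using e01
    · exact hK
  have hp : φ₀ p = !![1, 0; 0, 0] := by
    rw [hφ₀]
    ext k l
    fin_cases k <;> fin_cases l <;> simp [p] <;> field_simp <;> simp [D] <;> ring
  have hc₀ : φ₀ c₀ = !![0, β; 0, 0] := by
    rw [hφ₀]
    ext k l
    fin_cases k <;> fin_cases l <;> simp [c₀] <;> field_simp <;> simp [D] <;> ring
  have hb₀ : φ₀ b₀ = !![0, 0; β⁻¹, 0] := by
    rw [hφ₀]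
    ext k l
    fin_cases k <;> fin_cases l <;> simp [b₀] <;> field_simp <;> simp [D] <;> ring
  have hd₀ : φ₀ d₀ = !![0, 0; 0, 1] := by
    rw [hφ₀]
    ext k l
    fin_cases k <;> fin_cases l <;> simp [d₀] <;> field_simp <;> simp [D] <;> ring
  have hac : star a * c = star c * a := by
    have : star p * c₀ = star c₀ * p := hφinj <| by
      rw [map_mul, map_mul, hφ₀s, hφ₀s, hp, hc₀, adjugate_fin_two_of, adjugate_fin_two_of]
      ext k l
      fin_cases k <;> fin_cases l <;> simp
    simp only [a, c, star_eq_conjTranspose, diagonal_conjTranspose, diagonal_mul_diagonal]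
    congr 1; ext1 i
    by_cases hi : i = o <;> simp [hi, this]
  have hbd : star b * d = star d * b := by
    have : star b₀ * d₀ = star d₀ * b₀ := hφinj <| by
      rw [map_mul, map_mul, hφ₀s, hφ₀s, hb₀, hd₀, adjugate_fin_two_of, adjugate_fin_two_of]
      ext k l
      fin_cases k <;> fin_cases l <;> simp
    simp only [b, d, star_eq_conjTranspose, diagonal_conjTranspose, diagonal_mul_diagonal]
    congr 1; ext1 i
    by_cases hi : i = o <;> simp [hi, this]
  have h1 : star a * d - star c * b = 1 := by
    have : star p * d₀ - star c₀ * b₀ = 1 := hφinj <| by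
      rw [map_sub, map_mul, map_mul, map_one, hφ₀s, hφ₀s, hp, hc₀, hb₀, hd₀]
      ext k l
      fin_cases k <;> fin_cases l <;> simp [adjugate_fin_two_of, hβ]
    simp only [a, b, c, d, star_eq_conjTranspose, diagonal_conjTranspose, diagonal_mul_diagonal,
      diagonal_sub]
    rw [← diagonal_one]
    congr 1; ext1 i
    by_cases hi : i = o <;> simp [hi, this]
  -- The star of the unitary relation is the Bézout identity of the first column.
  have h1' : star d * a + (-star b) * c = 1 := by
    have := congrArg star h1
    simp only [star_sub, star_mul, star_star, star_one] at this
    rw [← this, neg_mul]; abel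
  obtain ⟨m, hm⟩ := hE a c ((isStarCoprimePair_iff _ _).2 ⟨⟨_, _, h1'⟩, by
    rw [isSelfAdjoint_iff, star_mul, star_star, hac]⟩)
  have hdet1 := hm.det_eq_one φ hdet hac hbd h1
  -- Regrouping the coordinates by `ι` makes the matrix block diagonal with $4\times4$ blocks, all
  -- equal to 1 except the one at `o`.
  let e : (Fin 2 ⊕ Fin 2) × ι ≃ ι × Fin 2 ⊕ ι × Fin 2 :=
    (Equiv.prodComm _ _).trans (Equiv.prodSumDistrib ι (Fin 2) (Fin 2))
  let G : ι → Matrix (Fin 2 ⊕ Fin 2) (Fin 2 ⊕ Fin 2) K := fun i ↦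
    if i = o then fromBlocks (φ₀ p) (φ₀ b₀) (φ₀ c₀) (φ₀ d₀) else 1
  have hG : (fromBlocks (φ a) (φ b) (φ c) (φ d)).submatrix e e = blockDiagonal G := by
    ext ⟨k, i⟩ ⟨l, j⟩
    by_cases hij : i = j
    · subst hij
      by_cases hi : i = o <;> rcases k with k | k <;> rcases l with l | l <;>
        simp [e, G, blockDiagonal_apply, hφ, a, b, c, d, hi, one_apply]
    · rcases k with k | k <;> rcases l with l | l <;>
        simp [e, G, blockDiagonal_apply, hφ, a, b, c, d, hij]
  rw [← det_submatrix_equiv_self e, hG, det_blockDiagonal, Finset.prod_eq_single o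
    (fun i _ hi ↦ by simp [G, hi]) (by simp)] at hdet1
  simp only [G, if_true, hp, hb₀, hc₀, hd₀] at hdet1
  have hd : (fromBlocks !![1, 0; 0, 0] !![0, 0; β⁻¹, 0] !![0, β; 0, 0] !![0, 0; 0, 1]).det = -1 := by
    rw [← det_submatrix_equiv_self (finSumFinEquiv (m := 2) (n := 2)).symm]
    have : (fromBlocks !![1, 0; 0, 0] !![0, 0; β⁻¹, 0] !![0, β; 0, 0] !![0, 0; 0, 1]).submatrix
        (finSumFinEquiv (m := 2) (n := 2)).symm (finSumFinEquiv (m := 2) (n := 2)).symm =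
        !![1, 0, 0, 0; 0, 0, β⁻¹, 0; 0, β, 0, 0; 0, 0, 0, 1] := by
      ext k l
      fin_cases k <;> fin_cases l <;> rfl
    rw [this]
    simp [det_succ_row_zero, Fin.sum_univ_succ, hβ]
  rw [hd] at hdet1
  exact h2 (by linear_combination -hdet1)

end QuaternionAlgebra

/-! ### Completions as direct factors of the adèles, and the conclusion -/

/-- The map of quaternion algebras induced by a non-unital map of coefficient rings. -/
@[simps]
def QuaternionAlgebra.mapNonUnitalRingHom {R S : Type*} [CommRing R] [CommRing S] (g : R →ₙ+* S)
    {a c : R} {a' c' : S} (ha : ∀ x, g (a * x) = a' * g x) (hc : ∀ x, g (c * x) = c' * g x) :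
    ℍ[R,a,1,c] →ₙ+* ℍ[S,a',1,c'] where
  toFun x := ⟨g x.re, g x.imI, g x.imJ, g x.imK⟩
  map_zero' := by ext <;> simp
  map_add' x y := by ext <;> simp
  map_mul' x y := by ext <;> simp [ha, hc, mul_assoc]

theorem QuaternionAlgebra.mapNonUnitalRingHom_star {R S : Type*} [CommRing R] [CommRing S]
    (g : R →ₙ+* S) {a c : R} {a' c' : S} (ha : ∀ x, g (a * x) = a' * g x)
    (hc : ∀ x, g (c * x) = c' * g x) (x : ℍ[R,a,1,c]) :
    mapNonUnitalRingHom g ha hc (star x) = star (mapNonUnitalRingHom g ha hc x) := by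
  ext <;> simp

/-- Applying a non-unital ring homomorphism to the entries of a matrix. -/
def Matrix.mapNonUnitalRingHom {A B : Type*} (n : Type*) [Fintype n] [Ring A] [Ring B] (f : A →ₙ+* B) :
    Matrix n n A →ₙ+* Matrix n n B where
  toFun M := M.map f
  map_zero' := Matrix.map_zero _ (map_zero f)
  map_add' := Matrix.map_add _ (map_add f)
  map_mul' _ _ := Matrix.map_mul

namespace GlobalField

variable {F : Type*} [Field F]

open Classical in
/-- The adele which is `x` at the place `v` and `0` elsewhere. -/
noncomputable def AdeleRing.single (v : FinitePlace F) : v.Completion →ₙ+* AdeleRing F where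
  toFun x := (0, ⟨Pi.single v x, by
    refine (Set.finite_singleton v).subset fun w hw ↦ ?_
    by_contra hne
    refine hw ?_
    have h0 : Pi.single (M := fun w : FinitePlace F ↦ w.Completion) v x w = 0 :=
      Pi.single_eq_of_ne hne x
    change Pi.single (M := fun w : FinitePlace F ↦ w.Completion) v x w ∈ w.integers
    rw [h0]
    exact zero_mem w.integers⟩)
  map_zero' := Prod.ext rfl (Subtype.ext (Pi.single_zero v))
  map_add' x y := Prod.ext (add_zero _).symm (Subtype.ext (Pi.single_add v x y))
  map_mul' x y := Prod.ext (mul_zero _).symm (Subtype.ext (Pi.single_mul v x y))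

theorem AdeleRing.proj_single (v : FinitePlace F) (x : v.Completion) :
    AdeleRing.proj v (AdeleRing.single v x) = x := by
  classical
  exact Pi.single_eq_same v x

theorem AdeleRing.single_algebraMap_mul [IsGlobalField F] (v : FinitePlace F) (α : F)
    (x : v.Completion) : AdeleRing.single v (algebraMap F v.Completion α * x) =
      algebraMap F (AdeleRing F) α * AdeleRing.single v x := by
  classical
  refine Prod.ext (mul_zero _).symm (Subtype.ext (funext fun w ↦ ?_))
  change Pi.single (M := fun w : FinitePlace F ↦ w.Completion) v (algebraMap F v.Completion α * x) w =
    algebraMap F w.Completion α * Pi.single (M := fun w : FinitePlace F ↦ w.Completion) v x w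
  by_cases h : w = v
  · subst h
    simp
  · simp [Pi.single_eq_of_ne h]

theorem exists_matrix_adelicQuaternions_ringEquiv (H : Type*) [IsGlobalField F] [Ring H] [Algebra F H]
    [IsQuaternionAlgebra F H] (n : Type*) [Fintype n] [DecidableEq n] : ∃ (α β : F)
      (e : Matrix n n (AdelicQuaternions F H) ≃+* Matrix n n
        ℍ[AdeleRing F,algebraMap F (AdeleRing F) α,1,algebraMap F (AdeleRing F) β]),
      β ≠ 0 ∧ 1 + 4 * α ≠ 0 ∧ ∀ x, e (star x) = star (e x) := by
  obtain ⟨α, β, e, hβ, hα, he⟩ := IsQuaternionAlgebra.exists_algEquiv F H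
  obtain ⟨E, hE⟩ := QuaternionAlgebra.exists_tensorProduct_ringEquiv e (canonicalInvolution F H) he
    (AdeleRing F)
  let E' : AdelicQuaternions F H ≃+*
    ℍ[AdeleRing F,algebraMap F (AdeleRing F) α,1,algebraMap F (AdeleRing F) β] := E
  have hE' : ∀ x, E' (star x) = star (E' x) := hE
  refine ⟨α, β, E'.mapMatrix, hβ, hα, fun x ↦ ?_⟩
  ext1 i j
  exact hE' (x j i)

theorem not_isStarEuclidean_matrix_adele [IsGlobalField F] (h2 : (2 : F) ≠ 0) {α β : F}
    (hα : 1 + 4 * α ≠ 0) (hβ : β ≠ 0) (ι : Type*) [Fintype ι] [DecidableEq ι] (o : ι) :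
    ¬ IsStarEuclidean (Matrix ι ι
      ℍ[AdeleRing F,algebraMap F (AdeleRing F) α,1,algebraMap F (AdeleRing F) β]) := by
  intro h
  obtain ⟨v, s, hs⟩ := FinitePlace.exists_mul_self_eq h2 hα
  let a := algebraMap F v.Completion
  have h2' : (2 : v.Completion) ≠ 0 := by
    rw [← map_ofNat a 2]; exact (map_ne_zero a).2 h2
  have hα' : 1 + 4 * a α ≠ 0 := by
    have := (map_ne_zero a).2 hα
    rwa [map_add, map_one, map_mul, map_ofNat] at this
  have hs' : s * s = 1 + 4 * a α := by
    rw [hs, map_add, map_one, map_mul, map_ofNat]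
  -- The quadratic formula: a square root $s$ of the discriminant gives a root of $X^2-X-\alpha$ in
  -- $F_v$, so the algebra splits at $v$.
  have hr : (1 + s) / 2 * ((1 + s) / 2) = a α + (1 + s) / 2 := by
    field_simp
    linear_combination hs'
  let f := QuaternionAlgebra.mapRingHom (AdeleRing.proj v) (AdeleRing.proj_algebraMap v α)
    (AdeleRing.proj_algebraMap v β)
  let g := QuaternionAlgebra.mapNonUnitalRingHom (AdeleRing.single v)
    (AdeleRing.single_algebraMap_mul v α) (AdeleRing.single_algebraMap_mul v β)
  -- The component at $v$ is a direct factor: projection has the extension by zero as a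
  -- multiplicative, non-unital section compatible with the involutions.
  refine QuaternionAlgebra.not_isStarEuclidean_matrix h2' hr hα' ((map_ne_zero a).2 hβ) ι o
    (h.of_section f.mapMatrix (Matrix.mapMatrix_star f (QuaternionAlgebra.mapRingHom_star _ _ _))
      (Matrix.mapNonUnitalRingHom ι g) (fun x ↦ ?_) fun x ↦ ?_)
  · ext1 i j
    exact QuaternionAlgebra.mapNonUnitalRingHom_star _ (AdeleRing.single_algebraMap_mul v α)
      (AdeleRing.single_algebraMap_mul v β) (x j i)
  · ext1 i j
    exact QuaternionAlgebra.ext (AdeleRing.proj_single v _) (AdeleRing.proj_single v _)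
      (AdeleRing.proj_single v _) (AdeleRing.proj_single v _)

end GlobalField

/-- The involution on the matrix ring is the `*`-transpose `(a_{ij})* = (a_{ji}*)`. -/
theorem mainTheorem3 {F : Type*} [Field F] [IsGlobalField F] {H : Type*} [Ring H] [Algebra F H]
    [IsQuaternionAlgebra F H] (n : ℕ) (hn : 1 ≤ n) :
    (ringChar F = 2 → IsStarEuclidean (Matrix (Fin n) (Fin n) (GlobalField.AdelicQuaternions F H)) ∧
      IsStarEuclideanOfLength (Matrix (Fin n) (Fin n) (GlobalField.AdelicQuaternions F H)) 1) ∧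
    (ringChar F ≠ 2 →
      ¬ IsStarEuclidean (Matrix (Fin n) (Fin n) (GlobalField.AdelicQuaternions F H))) := by
  obtain ⟨α, β, e, hβ, hα, he⟩ := GlobalField.exists_matrix_adelicQuaternions_ringEquiv H (Fin n)
    (F := F)
  have o : Fin n := ⟨0, hn⟩
  have : Nonempty (Fin n) := ⟨o⟩
  refine ⟨fun h ↦ ?_, fun h hE ↦ ?_⟩
  · have h2 : (2 : F) = 0 := by
      have := ringChar.Nat.cast_ringChar (R := F)
      rwa [h] at this
    have hred := (GlobalField.isStarUnitReducible_matrix_adele h2 α β hβ (Fin n)).of_ringEquiv e he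
    have : Nontrivial (Matrix (Fin n) (Fin n) (GlobalField.AdelicQuaternions F H)) :=
      e.toEquiv.nontrivial
    exact ⟨hred.isStarEuclidean, hred.isStarEuclideanOfLength⟩
  · exact GlobalField.not_isStarEuclidean_matrix_adele (Ring.two_ne_zero h) hα hβ (Fin n) o
      (hE.of_ringEquiv e he)
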